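/- **Proposition 3.2.** Consider the lattice graph $\mathbb{Z}^2$, in which $x\sim y$ if and only if $|x-y|=1$, where $|\cdot|$ is the Euclidean norm, with the Laplacian $\Delta u(x)=\sum_{y\sim x}(u(y)-u(x))$. For $\sigma\in\mathbb{R}$ let $\ell^\infty_\sigma(\mathbb{Z}^2)$ be the space of functions $f:\mathbb{Z}^2\to\mathbb{R}$ with $\sup_{x}|f(x)|(1+|x|)^\sigma<\infty$. Let $\kappa>0$, $\tau_0>2$ and $K,g\in\ell^\infty_{\tau_0}(\mathbb{Z}^2)$ with $K\ge 0$, $K\not\equiv 0$ and $\sum_{x\in\mathbb{Z}^2}g(x)>0$. Suppose that there is a constant $C_0\in\mathbb{R}$ such that $g(x)\le C_0K(x)$ for all $x\in\mathbb{Z}^2$. Then the equation $$-\Delta u+Ke^{\kappa u}=g\quad\text{in }\mathbb{Z}^2$$ has exactly one bounded solution $w_0$. Moreover, $\sum_{x\in\mathbb{Z}^2}K(x)e^{\kappa w_0(x)}=\sum_{x\in\mathbb{Z}^2}g(x)$ (the series converges), and there is $w_\infty\in\mathbb{R}$ such that $$w_0(x)=w_\infty+O\Big(|x|^{\frac{2-\tau_0}{\tau_0+1}}(\ln|x|)^{\frac1{\tau_0+1}}\Big)\quad\text{as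 }x\to\infty,$$ $$w_\infty\le\frac1\kappa\ln\Big(\sup_{\operatorname{supp}K}\frac gK\Big)\quad\text{and}\quad w_\infty\le\frac1\kappa\ln\Big(\|gK^{-1}\|_{\ell^\infty(\operatorname{supp}K)}\Big),$$ where $\operatorname{supp}K=\{x:K(x)\neq0\}$, the norm is $\sup_{\operatorname{supp}K}|g/K|\in[0,\infty]$, and $\ln\infty=\infty$. -/

import Mathlib

open Filter Asymptotics

/-- The Euclidean norm `|x|` of a lattice point `x ∈ ℤ²` (the instance norm on a product would be
the maximum norm). -/
noncomputable def latticeNorm (x : ℤ × ℤ) : ℝ :=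
  Real.sqrt ((x.1 : ℝ) ^ 2 + (x.2 : ℝ) ^ 2)

/-- The four neighbours of a vertex of the lattice graph `ℤ²`. -/
def latticeNeighbors (x : ℤ × ℤ) : Finset (ℤ × ℤ) :=
  {(x.1 + 1, x.2), (x.1 - 1, x.2), (x.1, x.2 + 1), (x.1, x.2 - 1)}

/-- The neighbours of `x` are exactly the lattice points at Euclidean distance one from `x`. -/
theorem mem_latticeNeighbors_iff (x y : ℤ × ℤ) :
    y ∈ latticeNeighbors x ↔ latticeNorm (x - y) = 1 := by
  obtain ⟨a, b⟩ := x
  obtain ⟨c, d⟩ := y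
  have key : latticeNorm ((a, b) - (c, d)) = 1 ↔ (a - c) ^ 2 + (b - d) ^ 2 = 1 := by
    unfold latticeNorm
    rw [Real.sqrt_eq_one]
    simp only [Prod.mk_sub_mk]
    exact_mod_cast Iff.rfl
  rw [key]
  simp only [latticeNeighbors, Finset.mem_insert, Finset.mem_singleton, Prod.mk.injEq]
  constructor
  · rintro (⟨rfl, rfl⟩ | ⟨rfl, rfl⟩ | ⟨rfl, rfl⟩ | ⟨rfl, rfl⟩) <;> ring
  · intro h
    have h1 : a - c ≤ 1 := by nlinarith [sq_nonneg (b - d)]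
    have h2 : -1 ≤ a - c := by nlinarith [sq_nonneg (b - d)]
    have h3 : b - d ≤ 1 := by nlinarith [sq_nonneg (a - c)]
    have h4 : -1 ≤ b - d := by nlinarith [sq_nonneg (a - c)]
    generalize hp : a - c = p at *
    generalize hq : b - d = q at *
    interval_cases p <;> interval_cases q <;> omega

/-- The discrete Laplacian `Δu(x) = ∑_{y ∼ x} (u(y) - u(x))` on `ℤ²`. -/
def latticeLaplacian (u : ℤ × ℤ → ℝ) (x : ℤ × ℤ) : ℝ :=
  ∑ y ∈ latticeNeighbors x, (u y - u x)

/-- Membership in the weighted space `ℓ^∞_σ(ℤ²)`: `sup_x |f(x)| (1 + |x|)^σ < ∞`. -/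
def MemWeightedLinfty (σ : ℝ) (f : ℤ × ℤ → ℝ) : Prop :=
  BddAbove (Set.range fun x => |f x| * (1 + latticeNorm x) ^ σ)

/-- The norm `‖g K⁻¹‖_{ℓ^∞(supp K)}`, as an element of `[0, ∞]`. -/
noncomputable def quotientSupNorm (g K : ℤ × ℤ → ℝ) : ENNReal :=
  ⨆ x ∈ Function.support K, ENNReal.ofReal |g x / K x|

/-- `u` is a bounded solution of `-Δu + K e^{κu} = g` in `ℤ²`. -/
def IsBoundedSolution (κ : ℝ) (K g u : ℤ × ℤ → ℝ) : Prop :=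
  (∃ C : ℝ, ∀ x, |u x| ≤ C) ∧
    ∀ x, -latticeLaplacian u x + K x * Real.exp (κ * u x) = g x

/-! The engine is the potential kernel `a` of `ℤ²`, with `Δa = π δ₀`: it is nonnegative, tends to
infinity, grows slower than every positive power, and has increments of size `‖y‖ / ‖x‖`. Since `a →
∞`, subtracting `ε a` from a function bounded above forces a maximum. Hence subharmonic functions
bounded above are constant (`eq_of_subharmonic_of_bddAbove`).

Convolving `f` with the increments of `a` solves `Δv = f - (∑ f) δ₀` with `v` decaying
(`exists_poisson_solution`). If `Δu = f` with `u` bounded, then `∑ f = 0`, since otherwise a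
multiple of `a` would make `u` or `-u` unbounded above; then `u - v` is constant. For `f = K e^{κw}
- g` this is both the mass identity and the asymptotics.

The Liouville theorem applied to `(u - v)⁺` gives a comparison principle, hence uniqueness and the
bound by `(1/κ) ln sup (g/K)`. Existence is Perron's method: `g ≤ C₀ K` makes a large constant a
supersolution, and `-v - E` is a subsolution when `Δv = g - cK` with `c = ∑ g / ∑ K > 0` and `E`
large. -/

/-! ### Dispersion relation of the separated harmonic functions. -/

/-- `sinh s`, where `cosh s = 2 - cos θ`. -/
noncomputable def dispersionSinh (θ : ℝ) : ℝ :=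
  Real.sqrt ((2 - Real.cos θ) ^ 2 - 1)

/-- `exp (-s)`, where `cosh s = 2 - cos θ`. -/
noncomputable def dispersionDecay (θ : ℝ) : ℝ :=
  2 - Real.cos θ - dispersionSinh θ

theorem dispersionSinh_sq (θ : ℝ) :
    dispersionSinh θ ^ 2 = (1 - Real.cos θ) * (3 - Real.cos θ) := by
  unfold dispersionSinh
  rw [Real.sq_sqrt]
  · ring
  · nlinarith [Real.cos_le_one θ]

theorem dispersionSinh_nonneg (θ : ℝ) : 0 ≤ dispersionSinh θ := Real.sqrt_nonneg _

/-- In `sinh² s = (1 - cos θ)(3 - cos θ)` the first factor is quadratic in `θ` and the second lies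
in `[2, 4]`. So `sinh s` is comparable to `θ`, which reduces all kernel integrals to elementary
ones. -/
theorem half_le_dispersionSinh {θ : ℝ} (h0 : 0 ≤ θ) (h1 : θ ≤ Real.pi) :
    θ / 2 ≤ dispersionSinh θ := by
  have h2 := Real.cos_le_one_sub_mul_cos_sq (x := θ) (by rw [abs_of_nonneg h0]; exact h1)
  have h3 : (1 : ℝ) / 8 ≤ 2 / Real.pi ^ 2 := by
    rw [div_le_div_iff₀ (by norm_num) (by positivity)]
    nlinarith [Real.pi_pos, Real.pi_le_four]
  have h4 : 1 / 8 * θ ^ 2 ≤ 1 - Real.cos θ := by nlinarith [sq_nonneg θ]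
  have h5 := Real.cos_le_one θ
  refine abs_le_of_sq_le_sq' ?_ (dispersionSinh_nonneg θ) |>.2
  rw [dispersionSinh_sq]
  nlinarith

theorem dispersionSinh_le {θ : ℝ} (h0 : 0 ≤ θ) : dispersionSinh θ ≤ 2 * θ := by
  have h2 := Real.one_sub_sq_div_two_le_cos (x := θ)
  have h5 := Real.cos_le_one θ
  have h6 := Real.neg_one_le_cos θ
  refine abs_le_of_sq_le_sq' ?_ (by positivity) |>.2
  rw [dispersionSinh_sq]
  nlinarith

theorem dispersionDecay_mul (θ : ℝ) :
    dispersionDecay θ * (2 - Real.cos θ + dispersionSinh θ) = 1 := by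
  have := dispersionSinh_sq θ
  unfold dispersionDecay
  nlinarith

theorem dispersionDecay_pos (θ : ℝ) : 0 < dispersionDecay θ := by
  have h1 := dispersionDecay_mul θ
  have h2 := Real.cos_le_one θ
  have h3 := dispersionSinh_nonneg θ
  by_contra! h
  nlinarith

theorem dispersionDecay_mul_one_add_le (θ : ℝ) :
    dispersionDecay θ * (1 + dispersionSinh θ) ≤ 1 := by
  have h1 := dispersionDecay_mul θ
  have h2 := Real.cos_le_one θ
  have h3 := dispersionDecay_pos θ
  nlinarith

theorem dispersionDecay_le_one (θ : ℝ) : dispersionDecay θ ≤ 1 := by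
  have h1 := dispersionDecay_mul_one_add_le θ
  have h3 := dispersionDecay_pos θ
  have h4 := dispersionSinh_nonneg θ
  nlinarith

theorem one_sub_dispersionDecay_le (θ : ℝ) : 1 - dispersionDecay θ ≤ dispersionSinh θ := by
  have := Real.cos_le_one θ
  unfold dispersionDecay
  linarith

theorem dispersionDecay_le_inv {θ : ℝ} (h0 : 0 ≤ θ) (h1 : θ ≤ Real.pi) :
    dispersionDecay θ ≤ (1 + θ / 2)⁻¹ := by
  rw [← one_div, le_div_iff₀ (by positivity)]
  have h2 := dispersionDecay_mul_one_add_le θ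
  have h3 := dispersionDecay_pos θ
  have h4 := half_le_dispersionSinh h0 h1
  nlinarith

theorem dispersionDecay_le_exp {θ : ℝ} (h0 : 0 ≤ θ) (h1 : θ ≤ Real.pi) :
    dispersionDecay θ ≤ Real.exp (-(θ / 6)) := by
  have h2 := dispersionDecay_le_inv h0 h1
  -- Equivalent to `θ ≤ 4` for `θ > 0`; this is where the rate `1/6` comes from.
  have h3 : (1 + θ / 2)⁻¹ ≤ 1 - θ / 6 := by
    rw [inv_le_iff_one_le_mul₀ (by positivity)]
    nlinarith [Real.pi_le_four]
  have h4 := Real.add_one_le_exp (-(θ / 6))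
  linarith

theorem continuous_dispersionSinh : Continuous dispersionSinh := by
  unfold dispersionSinh
  fun_prop

theorem continuous_dispersionDecay : Continuous dispersionDecay := by
  have := continuous_dispersionSinh
  unfold dispersionDecay
  fun_prop

theorem one_sub_dispersionDecay_pow_le (θ : ℝ) (n : ℕ) :
    1 - dispersionDecay θ ^ n ≤ n * dispersionSinh θ := by
  have h1 := one_sub_dispersionDecay_le θ
  have h2 := one_add_mul_le_pow (a := dispersionDecay θ - 1)
    (by have := dispersionDecay_pos θ; linarith) n
  have h3 : (n : ℝ) * (1 - dispersionDecay θ) ≤ n * dispersionSinh θ := by gcongr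
  have h4 : 1 + (dispersionDecay θ - 1) = dispersionDecay θ := by ring
  rw [h4] at h2
  linarith

/-! ### The potential kernel: growth and Laplacian. -/

/-- The integrand in the definition of the potential kernel. -/
noncomputable def kernelIntegrand (m n : ℤ) (θ : ℝ) : ℝ :=
  (1 - Real.cos (m * θ) * dispersionDecay θ ^ n.natAbs) / (2 * dispersionSinh θ)

/-- `π` times the potential kernel of simple random walk on `ℤ²`, normalised so that its
Laplacian is `π δ₀`. -/
noncomputable def latticeKernel (x : ℤ × ℤ) : ℝ :=
  ∫ θ in (0 : ℝ)..Real.pi, kernelIntegrand x.1 x.2 θ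

theorem decay_pow_le_one (θ : ℝ) (n : ℕ) : dispersionDecay θ ^ n ≤ 1 :=
  pow_le_one₀ (dispersionDecay_pos θ).le (dispersionDecay_le_one θ)

theorem cos_mul_decay_le (m : ℤ) (n : ℕ) (θ : ℝ) :
    Real.cos (m * θ) * dispersionDecay θ ^ n ≤ 1 := by
  have h1 := Real.cos_le_one (m * θ)
  have h2 := decay_pow_le_one θ n
  have h3 : 0 ≤ dispersionDecay θ ^ n := pow_nonneg (dispersionDecay_pos θ).le n
  nlinarith

theorem kernelIntegrand_nonneg (m n : ℤ) (θ : ℝ) : 0 ≤ kernelIntegrand m n θ := by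
  have h1 := cos_mul_decay_le m n.natAbs θ
  have h2 := dispersionSinh_nonneg θ
  unfold kernelIntegrand
  apply div_nonneg <;> linarith

theorem one_sub_cos_le_rpow {δ : ℝ} (hδ0 : 0 < δ) (hδ1 : δ ≤ 1) {t : ℝ} (ht : 0 ≤ t) :
    1 - Real.cos t ≤ 2 * t ^ δ := by
  have h0 : 0 ≤ t ^ δ := Real.rpow_nonneg ht _
  rcases le_total t 1 with h | h
  · have h1 := Real.abs_cos_sub_cos_le 0 t
    rw [Real.cos_zero, zero_sub, abs_neg, abs_of_nonneg ht] at h1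
    have h2 := le_abs_self (1 - Real.cos t)
    have h3 := Real.rpow_le_rpow_of_exponent_ge' ht h hδ0.le hδ1
    rw [Real.rpow_one] at h3
    linarith
  · have h1 := Real.neg_one_le_cos t
    have h2 := Real.one_le_rpow h hδ0.le
    linarith

theorem one_sub_pow_le_rpow {δ : ℝ} (hδ0 : 0 < δ) (hδ1 : δ ≤ 1) {θ : ℝ} (h0 : 0 ≤ θ) (n : ℕ) :
    1 - dispersionDecay θ ^ n ≤ 2 * (n * θ) ^ δ := by
  have ht : 0 ≤ n * θ := by positivity
  have hp : 0 ≤ (n * θ) ^ δ := Real.rpow_nonneg ht _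
  have hl : 0 ≤ dispersionDecay θ ^ n := pow_nonneg (dispersionDecay_pos θ).le n
  rcases le_total (n * θ) 1 with h | h
  · have h1 := one_sub_dispersionDecay_pow_le θ n
    have h2 : (n : ℝ) * dispersionSinh θ ≤ n * (2 * θ) := by gcongr; exact dispersionSinh_le h0
    have h3 := Real.rpow_le_rpow_of_exponent_ge' ht h hδ0.le hδ1
    rw [Real.rpow_one] at h3
    linarith
  · have h2 := Real.one_le_rpow h hδ0.le
    linarith

/-- The numerator is at most `(1 - cos(mθ)) + (1 - e^{-|n|s})`. Each summand is bounded both by a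
constant and linearly in `‖x‖ θ`, hence by its power `δ`. An arbitrarily small `δ` replaces the
sharp logarithmic upper bound. -/
theorem kernelIntegrand_le {δ : ℝ} (hδ0 : 0 < δ) (hδ1 : δ ≤ 1) (x : ℤ × ℤ) {θ : ℝ}
    (h0 : 0 < θ) (h1 : θ ≤ Real.pi) :
    kernelIntegrand x.1 x.2 θ ≤ 4 * ‖x‖ ^ δ * θ ^ (δ - 1) := by
  obtain ⟨m, n⟩ := x
  have hm : |(m : ℝ)| ≤ ‖(m, n)‖ := by
    simp [Prod.norm_def, Int.norm_eq_abs]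
  have hn : (n.natAbs : ℝ) ≤ ‖(m, n)‖ := by
    simp [Prod.norm_def, Int.norm_eq_abs, Nat.cast_natAbs]
  have hw := half_le_dispersionSinh h0.le h1
  have a1 : 1 - Real.cos (m * θ) ≤ 2 * (‖(m, n)‖ * θ) ^ δ := by
    rw [← Real.cos_abs, abs_mul, abs_of_pos h0]
    refine (one_sub_cos_le_rpow hδ0 hδ1 (by positivity)).trans ?_
    gcongr
  have a2 : 1 - dispersionDecay θ ^ n.natAbs ≤ 2 * (‖(m, n)‖ * θ) ^ δ := by
    refine (one_sub_pow_le_rpow hδ0 hδ1 h0.le _).trans ?_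
    gcongr
  have a3 : 1 - Real.cos (m * θ) * dispersionDecay θ ^ n.natAbs ≤
      4 * (‖(m, n)‖ * θ) ^ δ := by
    have b1 := Real.cos_le_one (m * θ)
    have b2 := decay_pow_le_one θ n.natAbs
    nlinarith
  have hn0 : (0 : ℝ) ≤ ‖(m, n)‖ := norm_nonneg _
  unfold kernelIntegrand
  rw [div_le_iff₀ (by linarith), Real.rpow_sub_one h0.ne']
  refine a3.trans ?_
  rw [Real.mul_rpow hn0 h0.le]
  have hp : 0 ≤ ‖(m, n)‖ ^ δ * (θ ^ δ / θ) := by positivity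
  calc 4 * (‖(m, n)‖ ^ δ * θ ^ δ) = 4 * (‖(m, n)‖ ^ δ * (θ ^ δ / θ)) * θ := by field_simp
    _ ≤ 4 * (‖(m, n)‖ ^ δ * (θ ^ δ / θ)) * (2 * dispersionSinh θ) := by gcongr; linarith
    _ = _ := by ring

theorem measurable_kernelIntegrand (m n : ℤ) : Measurable (kernelIntegrand m n) := by
  have h1 := continuous_dispersionSinh.measurable
  have h2 := continuous_dispersionDecay.measurable
  unfold kernelIntegrand
  fun_prop

theorem intervalIntegrable_kernelIntegrand (m n : ℤ) :
    IntervalIntegrable (kernelIntegrand m n) MeasureTheory.volume 0 Real.pi := by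
  have h := (intervalIntegral.intervalIntegrable_rpow' (a := 0) (b := Real.pi)
    (r := 1 - 1) (by norm_num)).const_mul (4 * ‖(m, n)‖ ^ (1 : ℝ))
  refine h.mono_fun (measurable_kernelIntegrand m n).aestronglyMeasurable ?_
  rw [Set.uIoc_of_le Real.pi_pos.le]
  refine (MeasureTheory.ae_restrict_iff' measurableSet_Ioc).2 (Eventually.of_forall ?_)
  intro θ hθ
  have := kernelIntegrand_le one_pos le_rfl (m, n) hθ.1 hθ.2
  beta_reduce
  rw [Real.norm_of_nonneg (kernelIntegrand_nonneg m n θ)]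
  exact this.trans (le_abs_self _)

theorem latticeKernel_nonneg (x : ℤ × ℤ) : 0 ≤ latticeKernel x :=
  intervalIntegral.integral_nonneg Real.pi_pos.le fun _ _ => kernelIntegrand_nonneg _ _ _

theorem exists_latticeKernel_le {δ : ℝ} (hδ0 : 0 < δ) (hδ1 : δ ≤ 1) :
    ∃ C, 0 ≤ C ∧ ∀ x, latticeKernel x ≤ C * ‖x‖ ^ δ := by
  refine ⟨4 * ∫ θ in (0 : ℝ)..Real.pi, θ ^ (δ - 1), ?_, fun x => ?_⟩
  · have : 0 ≤ ∫ θ in (0 : ℝ)..Real.pi, θ ^ (δ - 1) :=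
      intervalIntegral.integral_nonneg Real.pi_pos.le fun θ hθ => Real.rpow_nonneg hθ.1 _
    positivity
  · have h := (intervalIntegral.intervalIntegrable_rpow' (a := 0) (b := Real.pi)
      (r := δ - 1) (by linarith)).const_mul (4 * ‖x‖ ^ δ)
    calc latticeKernel x ≤ ∫ θ in (0 : ℝ)..Real.pi, 4 * ‖x‖ ^ δ * θ ^ (δ - 1) :=
          intervalIntegral.integral_mono_on_of_le_Ioo Real.pi_pos.le
            (intervalIntegrable_kernelIntegrand _ _) h
            fun θ hθ => kernelIntegrand_le hδ0 hδ1 x hθ.1 hθ.2.le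
      _ = _ := by rw [intervalIntegral.integral_const_mul]; ring

theorem latticeKernel_zero : latticeKernel 0 = 0 := by
  simp [latticeKernel, kernelIntegrand]

theorem latticeKernel_abs (m n : ℤ) : latticeKernel (|m|, |n|) = latticeKernel (m, n) := by
  unfold latticeKernel kernelIntegrand
  congr 1
  funext θ
  rcases abs_choice m with h | h <;> rcases abs_choice n with h' | h' <;> simp [h, h']

theorem latticeLaplacian_apply (u : ℤ × ℤ → ℝ) (m n : ℤ) :
    latticeLaplacian u (m, n) =
      u (m + 1, n) + u (m - 1, n) + u (m, n + 1) + u (m, n - 1) - 4 * u (m, n) := by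
  unfold latticeLaplacian latticeNeighbors
  rw [Finset.sum_insert, Finset.sum_insert, Finset.sum_insert, Finset.sum_singleton]
  · ring
  all_goals simp <;> omega

theorem decay_pow_add_decay_pow {n : ℤ} (hn : n ≠ 0) (θ : ℝ) :
    dispersionDecay θ ^ (n + 1).natAbs + dispersionDecay θ ^ (n - 1).natAbs =
      dispersionDecay θ ^ n.natAbs * (4 - 2 * Real.cos θ) := by
  have key : ∀ k : ℕ, dispersionDecay θ ^ (k + 2) + dispersionDecay θ ^ k =
      dispersionDecay θ ^ (k + 1) * (4 - 2 * Real.cos θ) := by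
    intro k
    have h1 := dispersionDecay_mul θ
    have h2 : dispersionDecay θ ^ 2 + 1 = dispersionDecay θ * (4 - 2 * Real.cos θ) := by
      rw [← h1]; unfold dispersionDecay; ring
    linear_combination dispersionDecay θ ^ k * h2
  rcases lt_or_gt_of_ne hn with h | h
  · obtain ⟨k, rfl⟩ : ∃ k : ℕ, n = -(k + 1) := ⟨(-n - 1).toNat, by omega⟩
    have e1 : (-((k : ℤ) + 1) + 1).natAbs = k := by omega
    have e2 : (-((k : ℤ) + 1) - 1).natAbs = k + 2 := by omega
    have e3 : (-((k : ℤ) + 1)).natAbs = k + 1 := by omega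
    rw [e1, e2, e3, ← key]; ring
  · obtain ⟨k, rfl⟩ : ∃ k : ℕ, n = k + 1 := ⟨(n - 1).toNat, by omega⟩
    have e1 : ((k : ℤ) + 1 + 1).natAbs = k + 2 := by omega
    have e2 : ((k : ℤ) + 1 - 1).natAbs = k := by omega
    have e3 : ((k : ℤ) + 1).natAbs = k + 1 := by omega
    rw [e1, e2, e3, ← key]

/-- The mode `cos(mθ) e^{-|n|s}` is harmonic off the line `n = 0`, because `cos θ + cosh s = 2`. On
that line the kink of `|n|` contributes `-2 sinh s`, which the denominator normalises. -/
theorem laplacian_kernelIntegrand (m n : ℤ) {θ : ℝ} (h0 : 0 < θ) (h1 : θ ≤ Real.pi) :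
    kernelIntegrand (m + 1) n θ + kernelIntegrand (m - 1) n θ + kernelIntegrand m (n + 1) θ +
      kernelIntegrand m (n - 1) θ - 4 * kernelIntegrand m n θ =
    if n = 0 then Real.cos (m * θ) else 0 := by
  have hw : 0 < dispersionSinh θ := by have := half_le_dispersionSinh h0.le h1; linarith
  have hc : Real.cos ((m + 1) * θ) + Real.cos ((m - 1) * θ) =
      2 * Real.cos (m * θ) * Real.cos θ := by
    rw [add_mul, sub_mul, one_mul, Real.cos_add, Real.cos_sub]; ring
  unfold kernelIntegrand
  push_cast
  generalize Real.cos ((m + 1) * θ) = c₁ at hc ⊢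
  generalize Real.cos ((m - 1) * θ) = c₂ at hc ⊢
  generalize Real.cos (m * θ) = c₀ at hc ⊢
  split_ifs with hn
  · subst hn
    simp only [Int.natAbs_zero, pow_zero, zero_add, zero_sub, Int.natAbs_neg, Int.natAbs_one,
      pow_one]
    have e2 : dispersionDecay θ = 2 - Real.cos θ - dispersionSinh θ := rfl
    rw [e2]
    field_simp
    linear_combination -hc
  · have hp := decay_pow_add_decay_pow hn θ
    field_simp
    linear_combination (-dispersionDecay θ ^ n.natAbs) * hc - c₀ * hp

theorem integral_cos_int_mul (m : ℤ) :
    ∫ θ in (0 : ℝ)..Real.pi, Real.cos (m * θ) = if m = 0 then Real.pi else 0 := by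
  split_ifs with h
  · simp [h]
  · have hm : (m : ℝ) ≠ 0 := by exact_mod_cast h
    rw [intervalIntegral.integral_comp_mul_left (fun t => Real.cos t) hm]
    simp [Real.sin_int_mul_pi]

theorem latticeLaplacian_latticeKernel (x : ℤ × ℤ) :
    latticeLaplacian latticeKernel x = if x = 0 then Real.pi else 0 := by
  obtain ⟨m, n⟩ := x
  rw [latticeLaplacian_apply]
  unfold latticeKernel
  simp only
  have I := intervalIntegrable_kernelIntegrand
  rw [← intervalIntegral.integral_add (I _ _) (I _ _),
    ← intervalIntegral.integral_add ((I _ _).add (I _ _)) (I _ _),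
    ← intervalIntegral.integral_add (((I _ _).add (I _ _)).add (I _ _)) (I _ _),
    ← intervalIntegral.integral_const_mul,
    ← intervalIntegral.integral_sub ((((I _ _).add (I _ _)).add (I _ _)).add (I _ _))
      ((I _ _).const_mul 4)]
  have : ∀ θ ∈ Set.uIoc 0 Real.pi,
      kernelIntegrand (m + 1) n θ + kernelIntegrand (m - 1) n θ + kernelIntegrand m (n + 1) θ +
      kernelIntegrand m (n - 1) θ - 4 * kernelIntegrand m n θ =
      if n = 0 then Real.cos (m * θ) else 0 := by
    intro θ hθ
    rw [Set.uIoc_of_le Real.pi_pos.le] at hθ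
    exact laplacian_kernelIntegrand m n hθ.1 hθ.2
  rw [intervalIntegral.integral_congr_ae (Eventually.of_forall this)]
  by_cases hn : n = 0
  · simp [hn, integral_cos_int_mul, Prod.ext_iff]
  · simp [hn, Prod.ext_iff]

/-! ### Kernel increments and logarithmic lower bound in terms of the height `|n|`. -/

theorem integral_decay_pow_le {k : ℕ} (hk : 0 < k) :
    ∫ θ in (0 : ℝ)..Real.pi, dispersionDecay θ ^ k ≤ 6 / k := by
  have hk' : (0 : ℝ) < k := by exact_mod_cast hk
  have hd : ∀ θ : ℝ, HasDerivAt (fun θ => -(6 / k) * Real.exp (-(k / 6) * θ))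
      (Real.exp (-(k / 6) * θ)) θ := by
    intro θ
    have h := (((hasDerivAt_id θ).const_mul (-((k : ℝ) / 6))).exp).const_mul (-(6 / (k : ℝ)))
    refine h.congr_deriv ?_
    simp only [id]
    field_simp
  have hi : IntervalIntegrable (fun θ : ℝ => Real.exp (-(k / 6) * θ)) MeasureTheory.volume 0
      Real.pi := Continuous.intervalIntegrable (by fun_prop) _ _
  calc ∫ θ in (0 : ℝ)..Real.pi, dispersionDecay θ ^ k
      ≤ ∫ θ in (0 : ℝ)..Real.pi, Real.exp (-(k / 6) * θ) := by
        refine intervalIntegral.integral_mono_on Real.pi_pos.le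
          ((continuous_dispersionDecay.pow k).intervalIntegrable _ _) hi fun θ hθ => ?_
        calc dispersionDecay θ ^ k ≤ Real.exp (-(θ / 6)) ^ k := by
              gcongr
              · exact (dispersionDecay_pos θ).le
              · exact dispersionDecay_le_exp hθ.1 hθ.2
          _ = Real.exp (-(k / 6) * θ) := by rw [← Real.exp_nat_mul]; congr 1; ring
    _ = -(6 / k) * Real.exp (-(k / 6) * Real.pi) - -(6 / k) * Real.exp (-(k / 6) * 0) :=
        intervalIntegral.integral_eq_sub_of_hasDerivAt (fun θ _ => hd θ) hi
    _ ≤ 6 / k := by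
        rw [mul_zero, Real.exp_zero]
        have : 0 ≤ 6 / k * Real.exp (-(k / 6) * Real.pi) := by positivity
        linarith

theorem abs_pow_sub_pow_le_of_le_one {a : ℝ} (h0 : 0 ≤ a) (h1 : a ≤ 1) {k p q : ℕ} (hp : k ≤ p)
    (hq : k ≤ q) : |a ^ p - a ^ q| ≤ |(p : ℝ) - q| * (1 - a) * a ^ k := by
  wlog h : p ≤ q generalizing p q
  · rw [abs_sub_comm, abs_sub_comm (p : ℝ)]
    exact this hq hp (by omega)
  obtain ⟨d, rfl⟩ := Nat.exists_eq_add_of_le h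
  have hb := one_add_mul_le_pow (a := a - 1) (by linarith) d
  rw [show 1 + (a - 1) = a by ring] at hb
  have h2 : a ^ p ≤ a ^ k := pow_le_pow_of_le_one h0 h1 hp
  have h3 : a ^ d ≤ 1 := pow_le_one₀ h0 h1
  have h4 : 0 ≤ a ^ p := pow_nonneg h0 _
  push_cast
  rw [show (p : ℝ) - (p + d) = -d by ring, abs_neg, Nat.abs_cast, pow_add,
    show a ^ p - a ^ p * a ^ d = a ^ p * (1 - a ^ d) by ring,
    abs_of_nonneg (mul_nonneg h4 (by linarith))]
  calc a ^ p * (1 - a ^ d) ≤ a ^ k * (d * (1 - a)) := by gcongr <;> linarith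
    _ = _ := by ring

/-- Changing `m` costs a factor `θ ≤ 2 sinh s`, changing `n` a factor `1 - e^{-s} ≤ sinh s`; both
absorb the singular denominator. What remains integrates to `O(1/k)`. -/
theorem abs_kernelIntegrand_sub_le {m m' n n' : ℤ} {k : ℕ} (hn : (k : ℤ) ≤ n)
    (hn' : (k : ℤ) ≤ n') {θ : ℝ} (h0 : 0 < θ) (h1 : θ ≤ Real.pi) :
    |kernelIntegrand m n θ - kernelIntegrand m' n' θ| ≤
      (|(m : ℝ) - m'| + |(n : ℝ) - n'|) * dispersionDecay θ ^ k := by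
  obtain ⟨p, rfl⟩ : ∃ p : ℕ, n = p := ⟨n.toNat, by omega⟩
  obtain ⟨q, rfl⟩ : ∃ q : ℕ, n' = q := ⟨n'.toNat, by omega⟩
  have hp : k ≤ p := by omega
  have hq : k ≤ q := by omega
  have hw := half_le_dispersionSinh h0.le h1
  have hw0 : 0 < dispersionSinh θ := by linarith
  have l0 := (dispersionDecay_pos θ).le
  have l1 := dispersionDecay_le_one θ
  have l2 := one_sub_dispersionDecay_le θ
  unfold kernelIntegrand
  simp only [Int.natAbs_natCast, Int.cast_natCast]
  rw [← sub_div, abs_div, abs_of_pos (by positivity : 0 < 2 * dispersionSinh θ),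
    div_le_iff₀ (by positivity)]
  set a := dispersionDecay θ
  set w := dispersionSinh θ
  have c1 : |Real.cos (m * θ) - Real.cos (m' * θ)| ≤ |(m : ℝ) - m'| * (2 * w) := by
    refine (Real.abs_cos_sub_cos_le _ _).trans ?_
    rw [← sub_mul, abs_mul, abs_of_pos h0]
    gcongr
    linarith
  have c2 := abs_pow_sub_pow_le_of_le_one l0 l1 hp hq
  have c3 : |a ^ p - a ^ q| ≤ |(p : ℝ) - q| * (2 * w) * a ^ k :=
    c2.trans (by gcongr; linarith)
  have c4 : a ^ p ≤ a ^ k := pow_le_pow_of_le_one l0 l1 hp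
  have c5 : |Real.cos (m' * θ)| ≤ 1 := Real.abs_cos_le_one _
  have e : 1 - Real.cos (m * θ) * a ^ p - (1 - Real.cos (m' * θ) * a ^ q) =
      -((Real.cos (m * θ) - Real.cos (m' * θ)) * a ^ p) +
        -(Real.cos (m' * θ) * (a ^ p - a ^ q)) := by ring
  rw [e]
  refine (abs_add_le _ _).trans ?_
  rw [abs_neg, abs_neg, abs_mul, abs_mul, abs_of_nonneg (pow_nonneg l0 p)]
  calc |Real.cos (m * θ) - Real.cos (m' * θ)| * a ^ p + |Real.cos (m' * θ)| * |a ^ p - a ^ q|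
      ≤ |(m : ℝ) - m'| * (2 * w) * a ^ k + 1 * (|(p : ℝ) - q| * (2 * w) * a ^ k) := by gcongr
    _ = _ := by ring

theorem abs_latticeKernel_sub_le {m m' n n' : ℤ} {k : ℕ} (hk : 0 < k) (hn : (k : ℤ) ≤ n)
    (hn' : (k : ℤ) ≤ n') :
    |latticeKernel (m, n) - latticeKernel (m', n')| ≤
      (|(m : ℝ) - m'| + |(n : ℝ) - n'|) * (6 / k) := by
  unfold latticeKernel
  simp only
  rw [← intervalIntegral.integral_sub (intervalIntegrable_kernelIntegrand _ _)
    (intervalIntegrable_kernelIntegrand _ _)]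
  have hi : IntervalIntegrable (fun θ => (|(m : ℝ) - m'| + |(n : ℝ) - n'|) *
      dispersionDecay θ ^ k) MeasureTheory.volume 0 Real.pi :=
    ((continuous_dispersionDecay.pow k).intervalIntegrable _ _).const_mul _
  have := intervalIntegral.norm_integral_le_of_norm_le Real.pi_pos.le
    (f := fun θ => kernelIntegrand m n θ - kernelIntegrand m' n' θ)
    (Eventually.of_forall fun θ hθ => by
      simpa using abs_kernelIntegrand_sub_le hn hn' hθ.1 hθ.2) hi
  refine this.trans ?_
  rw [intervalIntegral.integral_const_mul]
  gcongr
  exact integral_decay_pow_le hk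

theorem log_le_latticeKernel (m : ℤ) (n : ℤ) :
    (Real.log (8 + 4 * n.natAbs * Real.pi) - Real.log 8) / 4 ≤ latticeKernel (m, n) := by
  set k := n.natAbs
  -- A primitive of the minorant obtained from `e^{-ks} ≤ (1 + kθ/2)⁻¹` and `sinh s ≤ 2θ`.
  have hd : ∀ θ ∈ Set.uIcc 0 Real.pi,
      HasDerivAt (fun θ : ℝ => Real.log (8 + 4 * k * θ) / 4) (k / (8 + 4 * k * θ)) θ := by
    intro θ hθ
    rw [Set.uIcc_of_le Real.pi_pos.le] at hθ
    have hpos : 0 < 8 + 4 * k * θ := by have := hθ.1; positivity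
    have h := ((((hasDerivAt_id θ).const_mul (4 * (k : ℝ))).const_add 8).log
      hpos.ne').div_const 4
    refine h.congr_deriv ?_
    have hpos' : 8 + 4 * (k : ℝ) * id θ ≠ 0 := hpos.ne'
    simp only [id] at hpos' ⊢
    field_simp
  have hi : IntervalIntegrable (fun θ : ℝ => k / (8 + 4 * k * θ)) MeasureTheory.volume 0
      Real.pi := by
    apply ContinuousOn.intervalIntegrable
    intro θ hθ
    rw [Set.uIcc_of_le Real.pi_pos.le] at hθ
    have hpos : 0 < 8 + 4 * k * θ := by have := hθ.1; positivity
    exact ContinuousAt.continuousWithinAt (by fun_prop (disch := exact hpos.ne'))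
  have hint := intervalIntegral.integral_eq_sub_of_hasDerivAt hd hi
  have : (Real.log (8 + 4 * n.natAbs * Real.pi) - Real.log 8) / 4 =
      ∫ θ in (0 : ℝ)..Real.pi, k / (8 + 4 * k * θ) := by
    rw [hint, mul_zero, add_zero]; ring
  rw [this]
  refine intervalIntegral.integral_mono_on_of_le_Ioo Real.pi_pos.le hi
    (intervalIntegrable_kernelIntegrand _ _) fun θ hθ => ?_
  have h0 := hθ.1
  have l0 := (dispersionDecay_pos θ).le
  have hl : dispersionDecay θ ^ k ≤ (1 + k * (θ / 2))⁻¹ := by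
    calc dispersionDecay θ ^ k ≤ ((1 + θ / 2)⁻¹) ^ k := by
          gcongr; exact dispersionDecay_le_inv h0.le hθ.2.le
      _ = ((1 + θ / 2) ^ k)⁻¹ := inv_pow _ _
      _ ≤ _ := by
          gcongr
          exact one_add_mul_le_pow (by linarith) k
  have hw : 0 < dispersionSinh θ := by
    have := half_le_dispersionSinh h0.le hθ.2.le; linarith
  have hc : Real.cos (m * θ) * dispersionDecay θ ^ k ≤ (1 + k * (θ / 2))⁻¹ := by
    have h1 := Real.cos_le_one (m * θ)
    have h3 : 0 ≤ dispersionDecay θ ^ k := pow_nonneg l0 k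
    nlinarith
  calc (k : ℝ) / (8 + 4 * k * θ) = (1 - (1 + k * (θ / 2))⁻¹) / (2 * (2 * θ)) := by
        field_simp; ring
    _ ≤ (1 - Real.cos (m * θ) * dispersionDecay θ ^ k) / (2 * dispersionSinh θ) := by
        have h5 := cos_mul_decay_le m k θ
        have h6 := dispersionSinh_le h0.le
        gcongr

/-! ### Symmetry of the kernel and its divergence at infinity. -/

theorem norm_intPair (m n : ℤ) : ‖(m, n)‖ = max |(m : ℝ)| |(n : ℝ)| := by
  simp [Prod.norm_def, Int.norm_eq_abs]

/-- A Phragmén–Lindelöf argument on a half-plane: growth of order `√‖x‖` is too slow for a harmonic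
function vanishing on the diagonal. Antisymmetry enters only through the zero values there. -/
theorem nonpos_of_antisymm_harmonic {H : ℤ × ℤ → ℝ} (hH : ∀ x, latticeLaplacian H x = 0)
    (hd : ∀ m, H (m, m) = 0) {C : ℝ} (hC0 : 0 < C) (hC : ∀ x, |H x| ≤ C * Real.sqrt ‖x‖)
    {m n : ℤ} (h : n ≤ m) : H (m, n) ≤ 0 := by
  have key : ∀ R : ℕ, 1 ≤ R → m - n ≤ R → |m + n| ≤ R →
      H (m, n) ≤ C * ((m + n) ^ 2 + 4 * (m - n)) * (Real.sqrt R)⁻¹ := by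
    intro R hR1 hR2 hR3
    have hR : (1 : ℝ) ≤ R := by exact_mod_cast hR1
    set M := C * Real.sqrt R with hM
    have hM0 : 0 < M := by positivity
    -- With `s = m + n` and `d = m - n`, the barrier `M (s² + 4Rd - 2d²)/R²` has Laplacian `-4M/R²`.
    -- On the rectangle `0 ≤ d ≤ R`, `|s| ≤ R` it is nonnegative at `d = 0` and at least `M ≥ |H|`
    -- on the other sides.
    let D : ℤ × ℤ → ℝ := fun x =>
      M * ((x.1 + x.2 : ℝ) ^ 2 + 4 * R * (x.1 - x.2) - 2 * (x.1 - x.2 : ℝ) ^ 2) / R ^ 2 - H x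
    have hDdef : ∀ a b : ℤ, D (a, b) =
      M * ((a + b : ℝ) ^ 2 + 4 * R * (a - b) - 2 * (a - b : ℝ) ^ 2) / R ^ 2 - H (a, b) :=
      fun _ _ => rfl
    let Ω : Finset (ℤ × ℤ) := (Finset.Icc (-(R : ℤ)) R ×ˢ Finset.Icc (-(R : ℤ)) R).filter
      fun x => 0 ≤ x.1 - x.2 ∧ x.1 - x.2 ≤ R ∧ |x.1 + x.2| ≤ R
    have hΩ : ∀ a b : ℤ, (a, b) ∈ Ω ↔ 0 ≤ a - b ∧ a - b ≤ R ∧ |a + b| ≤ R := by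
      intro a b
      simp only [Ω, Finset.mem_filter, Finset.mem_product, Finset.mem_Icc]
      constructor
      · exact fun h => h.2
      · intro h
        refine ⟨?_, h⟩
        have := abs_le.1 h.2.2
        omega
    have hmem : (m, n) ∈ Ω := (hΩ m n).2 ⟨by omega, hR2, hR3⟩
    obtain ⟨⟨a, b⟩, hab, hmin⟩ := Ω.exists_min_image D ⟨_, hmem⟩
    have hab' := (hΩ a b).1 hab
    have hHM : |H (a, b)| ≤ M := by
      refine (hC _).trans ?_
      rw [hM]
      gcongr
      have h1 := abs_le.1 hab'.2.2
      rw [norm_intPair]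
      refine max_le ?_ ?_
      · have : |a| ≤ R := abs_le.2 (by omega)
        exact_mod_cast this
      · have : |b| ≤ R := abs_le.2 (by omega)
        exact_mod_cast this
    have hHM' := abs_le.1 hHM
    have p0 : (0 : ℝ) ≤ a - b := by exact_mod_cast hab'.1
    have p1 : (a - b : ℝ) ≤ R := by exact_mod_cast hab'.2.1
    have hD0 : 0 ≤ D (a, b) := by
      by_cases h1 : a = b
      · subst h1
        have e : D (a, a) = M * (a + a : ℝ) ^ 2 / R ^ 2 := by
          rw [hDdef, hd]; ring
        rw [e]
        positivity
      by_cases h2 : a - b = R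
      · have h2' : (a - b : ℝ) = R := by exact_mod_cast h2
        have : M ≤ M * ((a + b : ℝ) ^ 2 + 4 * R * (a - b) - 2 * (a - b : ℝ) ^ 2) / R ^ 2 := by
          rw [le_div_iff₀ (by positivity), h2']
          gcongr
          nlinarith [sq_nonneg (a + b : ℝ)]
        rw [hDdef]
        linarith
      by_cases h3 : |a + b| = R
      · have h3' : (a + b : ℝ) ^ 2 = R ^ 2 := by
          rw [← sq_abs]
          congr 1
          exact_mod_cast h3
        have : M ≤ M * ((a + b : ℝ) ^ 2 + 4 * R * (a - b) - 2 * (a - b : ℝ) ^ 2) / R ^ 2 := by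
          rw [le_div_iff₀ (by positivity), h3']
          gcongr
          nlinarith
        rw [hDdef]
        linarith
      -- An interior minimum of `D` is incompatible with its strictly negative Laplacian.
      exfalso
      have q1 := lt_of_le_of_ne hab'.2.2 h3
      rw [abs_lt] at q1
      have i1 := hmin (a + 1, b) ((hΩ _ _).2 ⟨by omega, by omega, abs_le.2 (by omega)⟩)
      have i2 := hmin (a - 1, b) ((hΩ _ _).2 ⟨by omega, by omega, abs_le.2 (by omega)⟩)
      have i3 := hmin (a, b + 1) ((hΩ _ _).2 ⟨by omega, by omega, abs_le.2 (by omega)⟩)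
      have i4 := hmin (a, b - 1) ((hΩ _ _).2 ⟨by omega, by omega, abs_le.2 (by omega)⟩)
      have e := hH (a, b)
      rw [latticeLaplacian_apply] at e
      have e2 : D (a + 1, b) + D (a - 1, b) + D (a, b + 1) + D (a, b - 1) - 4 * D (a, b) =
          -(4 * M / R ^ 2) := by
        simp only [hDdef]
        push_cast
        linear_combination -e
      have : 0 < 4 * M / (R : ℝ) ^ 2 := by positivity
      linarith
    have hfin := hD0.trans (hmin _ hmem)
    rw [hDdef] at hfin
    have hp : (0 : ℝ) ≤ m - n := by
      have : (n : ℝ) ≤ m := by exact_mod_cast h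
      linarith
    have hs : Real.sqrt R * Real.sqrt R = R := Real.mul_self_sqrt (by positivity)
    have hs0 : 0 < Real.sqrt R := by positivity
    calc H (m, n) ≤ M * ((m + n : ℝ) ^ 2 + 4 * R * (m - n) - 2 * (m - n : ℝ) ^ 2) / R ^ 2 := by
          linarith
      _ ≤ M * (R * ((m + n : ℝ) ^ 2 + 4 * (m - n))) / R ^ 2 := by
          gcongr
          nlinarith [sq_nonneg (m + n : ℝ), sq_nonneg (m - n : ℝ)]
      _ = C * ((m + n) ^ 2 + 4 * (m - n)) * (Real.sqrt R / R) := by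
          rw [hM]; field_simp
      _ = _ := by
          congr 1
          rw [div_eq_iff (by positivity)]
          field_simp
          linarith
  have ht : Tendsto (fun R : ℕ => C * ((m + n : ℝ) ^ 2 + 4 * (m - n)) * (Real.sqrt R)⁻¹) atTop
      (nhds (C * ((m + n : ℝ) ^ 2 + 4 * (m - n)) * 0)) :=
    ((Real.tendsto_sqrt_atTop.comp tendsto_natCast_atTop_atTop).inv_tendsto_atTop).const_mul _
  rw [mul_zero] at ht
  refine ge_of_tendsto ht ?_
  filter_upwards [eventually_ge_atTop (1 + (m - n).natAbs + (m + n).natAbs)] with R hR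
  exact key R (by omega) (by omega) (abs_le.2 (by omega))

/-- The integral treats the two axes differently, so this symmetry is not visible in it. The
difference of the kernel and its reflection is harmonic, zero on the diagonal and `O(√‖x‖)`; the
half-plane lemma applies to it with both signs. -/
theorem latticeKernel_swap (m n : ℤ) : latticeKernel (n, m) = latticeKernel (m, n) := by
  obtain ⟨C, hC0, hC⟩ := exists_latticeKernel_le (δ := 1 / 2) (by norm_num) (by norm_num)
  have main : ∀ m n : ℤ, n ≤ m → latticeKernel (n, m) = latticeKernel (m, n) := by
    have gen : ∀ s : ℝ, |s| = 1 → ∀ m n : ℤ, n ≤ m →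
        s * (latticeKernel (m, n) - latticeKernel (n, m)) ≤ 0 := by
      intro s hs m n hmn
      refine nonpos_of_antisymm_harmonic
        (H := fun x => s * (latticeKernel x - latticeKernel (x.2, x.1)))
        (C := 2 * C + 1) ?_ ?_ (by linarith) ?_ hmn
      · rintro ⟨a, b⟩
        have e1 := latticeLaplacian_latticeKernel (a, b)
        have e2 := latticeLaplacian_latticeKernel (b, a)
        have e3 : ((b, a) = (0 : ℤ × ℤ)) ↔ ((a, b) = (0 : ℤ × ℤ)) := by
          simp [Prod.ext_iff, and_comm]
        simp only [e3] at e2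
        rw [latticeLaplacian_apply] at e1 e2 ⊢
        linear_combination s * e1 - s * e2
      · intro a
        simp
      · rintro ⟨a, b⟩
        have h1 := hC (a, b)
        have h2 := hC (b, a)
        have h3 := latticeKernel_nonneg (a, b)
        have h4 := latticeKernel_nonneg (b, a)
        have h5 : ‖(b, a)‖ = ‖(a, b)‖ := by rw [norm_intPair, norm_intPair, max_comm]
        rw [h5] at h2
        rw [← Real.sqrt_eq_rpow] at h1 h2
        have h6 := Real.sqrt_nonneg ‖(a, b)‖
        rw [abs_mul, hs, one_mul, abs_le]
        simp only
        constructor <;> nlinarith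
    intro m n hmn
    have h1 := gen 1 (by simp) m n hmn
    have h2 := gen (-1) (by simp) m n hmn
    linarith
  rcases le_total n m with h | h
  · exact main m n h
  · exact (main n m h).symm

theorem log_norm_le_latticeKernel (x : ℤ × ℤ) :
    (Real.log (8 + 4 * ‖x‖ * Real.pi) - Real.log 8) / 4 ≤ latticeKernel x := by
  obtain ⟨m, n⟩ := x
  rw [norm_intPair]
  rcases le_total |(m : ℝ)| |(n : ℝ)| with h | h
  · rw [max_eq_right h]
    have := log_le_latticeKernel m n
    rwa [Nat.cast_natAbs, Int.cast_abs] at this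
  · rw [max_eq_left h, ← latticeKernel_swap]
    have := log_le_latticeKernel n m
    rwa [Nat.cast_natAbs, Int.cast_abs] at this

theorem tendsto_norm_intPair : Tendsto (fun x : ℤ × ℤ => ‖x‖) cofinite atTop := by
  rw [← cocompact_eq_cofinite]
  exact tendsto_norm_cocompact_atTop

theorem tendsto_latticeKernel : Tendsto latticeKernel cofinite atTop := by
  refine tendsto_atTop_mono log_norm_le_latticeKernel ?_
  refine Tendsto.atTop_div_const (by norm_num) ?_
  refine tendsto_atTop_add_const_right _ _ ?_
  refine Real.tendsto_log_atTop.comp ?_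
  refine tendsto_atTop_add_const_left _ _ ?_
  refine Tendsto.atTop_mul_const Real.pi_pos ?_
  exact tendsto_norm_intPair.const_mul_atTop (by norm_num)

/-! ### Liouville theorem for subharmonic functions bounded above. -/

theorem le_apply_zero_of_subharmonic {u : ℤ × ℤ → ℝ} {B : ℝ} (hB : ∀ x, u x ≤ B)
    (hu : ∀ x, 0 ≤ latticeLaplacian u x) (x : ℤ × ℤ) : u x ≤ u 0 := by
  have key : ∀ ε : ℝ, 0 < ε → u x - ε * latticeKernel x ≤ u 0 := by
    intro ε hε
    set D : ℤ × ℤ → ℝ := fun x => u x - ε * latticeKernel x with hD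
    have hlim : Tendsto D (cocompact _) atBot := by
      rw [cocompact_eq_cofinite]
      have h1 : Tendsto (fun x => B + -(ε * latticeKernel x)) cofinite atBot :=
        tendsto_atBot_add_const_left _ _
          (tendsto_neg_atTop_atBot.comp (tendsto_latticeKernel.const_mul_atTop hε))
      refine tendsto_atBot_mono (fun x => ?_) h1
      have := hB x
      simp only [hD]
      linarith
    obtain ⟨z, hz⟩ := (continuous_of_discreteTopology (f := D)).exists_forall_ge hlim
    -- Away from `0` the function `D` is subharmonic, so all neighbours of a maximum point are
    -- maximum points. One of them is closer to the origin in the `ℓ¹` distance.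
    have descend : ∀ k : ℕ, ∀ z : ℤ × ℤ, z.1.natAbs + z.2.natAbs = k → (∀ y, D y ≤ D z) →
        D z ≤ D 0 := by
      intro k
      induction k using Nat.strong_induction_on with
      | _ k ih =>
        rintro ⟨a, b⟩ hk hmax
        by_cases h0 : ((a, b) : ℤ × ℤ) = 0
        · rw [h0]
        have e1 := latticeLaplacian_latticeKernel (a, b)
        have e2 := hu (a, b)
        rw [if_neg h0] at e1
        rw [latticeLaplacian_apply] at e1 e2
        have i1 := hmax (a + 1, b)
        have i2 := hmax (a - 1, b)
        have i3 := hmax (a, b + 1)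
        have i4 := hmax (a, b - 1)
        have e3 : 4 * D (a, b) ≤ D (a + 1, b) + D (a - 1, b) + D (a, b + 1) + D (a, b - 1) := by
          simp only [hD]
          nlinarith
        have go : ∀ y : ℤ × ℤ, D y = D (a, b) → y.1.natAbs + y.2.natAbs < k →
            D (a, b) ≤ D 0 := by
          intro y hy hlt
          rw [← hy]
          exact ih _ hlt y rfl (by rw [hy]; exact hmax)
        simp only at hk
        rcases lt_trichotomy a 0 with ha | ha | ha
        · exact go (a + 1, b) (by linarith) (by simp only; omega)
        · rcases lt_trichotomy b 0 with hb | hb | hb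
          · exact go (a, b + 1) (by linarith) (by simp only; omega)
          · exact absurd (by simp [ha, hb]) h0
          · exact go (a, b - 1) (by linarith) (by simp only; omega)
        · exact go (a - 1, b) (by linarith) (by simp only; omega)
    calc D x ≤ D z := hz x
      _ ≤ D 0 := descend _ z rfl hz
      _ = u 0 := by simp [hD, latticeKernel_zero]
  have ht : Tendsto (fun ε : ℝ => u x - ε * latticeKernel x) (nhdsWithin 0 (Set.Ioi 0))
      (nhds (u x - 0 * latticeKernel x)) :=
    ((continuous_const.sub (continuous_id.mul continuous_const)).tendsto 0).mono_left
      nhdsWithin_le_nhds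
  rw [zero_mul, sub_zero] at ht
  exact le_of_tendsto ht (by filter_upwards [self_mem_nhdsWithin] with ε hε using key ε hε)

theorem eq_of_subharmonic_of_bddAbove {u : ℤ × ℤ → ℝ} {B : ℝ} (hB : ∀ x, u x ≤ B)
    (hu : ∀ x, 0 ≤ latticeLaplacian u x) (x y : ℤ × ℤ) : u x = u y := by
  have key : ∀ x y : ℤ × ℤ, u x ≤ u y := by
    intro x y
    have := le_apply_zero_of_subharmonic (u := fun z => u (y + z)) (fun z => hB _)
      (by
        rintro ⟨a, b⟩
        obtain ⟨c, d⟩ := y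
        have := hu ((c, d) + (a, b))
        simp only [Prod.mk_add_mk] at this
        rw [latticeLaplacian_apply] at this ⊢
        simpa only [Prod.mk_add_mk, add_assoc, add_sub_assoc] using this) (x - y)
    simpa using this
  exact le_antisymm (key x y) (key y x)

/-! ### Kernel increments in every direction. -/

theorem abs_latticeKernel_sub_le_of_pos {a b c d : ℤ} (hb : 0 < b)
    (hd : 4 * |d| ≤ b) :
    |latticeKernel (a - c, b - d) - latticeKernel (a, b)| ≤ 16 * ‖(c, d)‖ / b := by
  obtain ⟨k, hk⟩ : ∃ k : ℕ, (k : ℤ) = b - |d| := ⟨(b - |d|).toNat, by omega⟩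
  have h1 := le_abs_self d
  have h2 := abs_nonneg d
  have hk0 : 0 < k := by omega
  have h := abs_latticeKernel_sub_le (m := a - c) (m' := a) (n := b - d) (n' := b) hk0
    (by omega) (by omega)
  refine h.trans ?_
  have hkb : (3 * b : ℝ) ≤ 4 * k := by exact_mod_cast (by omega : 3 * b ≤ 4 * (k : ℤ))
  have hb' : (0 : ℝ) < b := by exact_mod_cast hb
  have hk' : (0 : ℝ) < k := by exact_mod_cast hk0
  have e1 : ((a - c : ℤ) : ℝ) - a = -c := by push_cast; ring
  have e2 : ((b - d : ℤ) : ℝ) - b = -d := by push_cast; ring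
  rw [e1, e2, abs_neg, abs_neg, norm_intPair]
  have m1 := le_max_left |(c : ℝ)| |(d : ℝ)|
  have m2 := le_max_right |(c : ℝ)| |(d : ℝ)|
  have m0 : 0 ≤ max |(c : ℝ)| |(d : ℝ)| := (abs_nonneg _).trans m1
  have h6 : 6 / (k : ℝ) ≤ 8 / b := by
    rw [div_le_div_iff₀ hk' hb']; linarith
  calc (|(c : ℝ)| + |(d : ℝ)|) * (6 / k) ≤ (2 * max |(c : ℝ)| |(d : ℝ)|) * (8 / b) := by
        gcongr
        linarith
    _ = _ := by ring

theorem abs_latticeKernel_sub_le_of_norm {x y : ℤ × ℤ} (hx : x ≠ 0) (hxy : 4 * ‖y‖ ≤ ‖x‖) :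
    |latticeKernel (x - y) - latticeKernel x| ≤ 16 * ‖y‖ / ‖x‖ := by
  have refl : ∀ a b : ℤ, latticeKernel (a, -b) = latticeKernel (a, b) := by
    intro a b
    rw [← latticeKernel_abs, abs_neg, latticeKernel_abs]
  have up : ∀ a b c d : ℤ, (a, b) ≠ 0 → 4 * ‖(c, d)‖ ≤ ‖(a, b)‖ → |a| ≤ |b| →
      |latticeKernel (a - c, b - d) - latticeKernel (a, b)| ≤ 16 * ‖(c, d)‖ / ‖(a, b)‖ := by
    intro a b c d h0 h h1
    have h1' : |(a : ℝ)| ≤ |(b : ℝ)| := by exact_mod_cast h1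
    have hn : ‖(a, b)‖ = |(b : ℝ)| := by rw [norm_intPair, max_eq_right h1']
    rw [hn] at h ⊢
    have hd : 4 * |d| ≤ |b| := by
      have : 4 * |(d : ℝ)| ≤ |(b : ℝ)| := by
        rw [norm_intPair] at h
        have := le_max_right |(c : ℝ)| |(d : ℝ)|
        linarith
      exact_mod_cast this
    have hb : b ≠ 0 := by
      rintro rfl
      have ha : a = 0 := by simpa using h1
      exact h0 (by simp [ha])
    rcases lt_or_gt_of_ne hb with hb | hb
    · rw [abs_of_neg hb] at hd
      have := abs_latticeKernel_sub_le_of_pos (a := a) (b := -b) (c := c) (d := -d) (by omega)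
        (by rwa [abs_neg])
      rw [show -b - -d = -(b - d) by ring, refl, refl] at this
      refine this.trans_eq ?_
      rw [norm_intPair, norm_intPair, abs_of_neg (by exact_mod_cast hb : (b : ℝ) < 0)]
      push_cast
      rw [abs_neg]
    · rw [abs_of_pos hb] at hd
      rw [abs_of_pos (by exact_mod_cast hb : (0 : ℝ) < b)]
      exact abs_latticeKernel_sub_le_of_pos hb hd
  obtain ⟨a, b⟩ := x
  obtain ⟨c, d⟩ := y
  rw [Prod.mk_sub_mk]
  rcases le_total |a| |b| with h | h
  · exact up a b c d hx hxy h
  · have sw : ∀ p q : ℤ, ‖(p, q)‖ = ‖(q, p)‖ := fun p q => by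
      rw [norm_intPair, norm_intPair, max_comm]
    rw [← latticeKernel_swap, ← latticeKernel_swap a b, sw a, sw c]
    refine up b a d c ?_ ?_ h
    · simpa [Prod.ext_iff, and_comm] using hx
    · rwa [sw d, sw b]

/-- For `4‖y‖ ≤ ‖x‖` the gradient bound applies, and raising a ratio at most `1` to the power `α ≤
1` only enlarges it. Otherwise the ratio is at least `1/4`, and the growth bound suffices. The
weight in `y` is the price for uniform decay in `x`. -/
theorem exists_abs_latticeKernel_sub_le {α δ : ℝ} (hα0 : 0 < α) (hα1 : α ≤ 1) (hδ0 : 0 < δ)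
    (hδ1 : δ ≤ 1) : ∃ C, 0 ≤ C ∧ ∀ x y : ℤ × ℤ,
      |latticeKernel (x - y) - latticeKernel x| ≤
        C * ((1 + ‖y‖) ^ (α + δ) * (1 + ‖x‖) ^ (-α)) := by
  obtain ⟨C, hC0, hC⟩ := exists_latticeKernel_le hδ0 hδ1
  refine ⟨max 32 (40 * C), by positivity, fun x y => ?_⟩
  have hx0 : 0 ≤ ‖x‖ := norm_nonneg x
  have hy0 : 0 ≤ ‖y‖ := norm_nonneg y
  have hsplit : (1 + ‖y‖) ^ (α + δ) * (1 + ‖x‖) ^ (-α) =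
      ((1 + ‖y‖) / (1 + ‖x‖)) ^ α * (1 + ‖y‖) ^ δ := by
    rw [Real.rpow_add (by positivity), Real.rpow_neg (by positivity),
      Real.div_rpow (by positivity) (by positivity)]
    ring
  have hδy : 1 ≤ (1 + ‖y‖) ^ δ := Real.one_le_rpow (by linarith) hδ0.le
  have hr0 : 0 < (1 + ‖y‖) / (1 + ‖x‖) := by positivity
  have hrα : 0 < ((1 + ‖y‖) / (1 + ‖x‖)) ^ α := by positivity
  rw [hsplit]
  rcases le_or_gt (4 * ‖y‖) ‖x‖ with h | h
  · by_cases hx : x = 0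
    · have hy : y = 0 := by
        rw [hx, norm_zero] at h
        exact norm_le_zero_iff.1 (by linarith)
      rw [hy, sub_zero, sub_self, abs_zero]
      positivity
    have hx1 : 1 ≤ ‖x‖ := by
      obtain ⟨a, b⟩ := x
      rw [norm_intPair]
      by_cases ha : a = 0
      · have hb : b ≠ 0 := fun hb => hx (by simp [ha, hb])
        exact le_max_of_le_right (by exact_mod_cast Int.one_le_abs hb)
      · exact le_max_of_le_left (by exact_mod_cast Int.one_le_abs ha)
    have hr1 : (1 + ‖y‖) / (1 + ‖x‖) ≤ 1 := by
      rw [div_le_one (by positivity)]; linarith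
    have hrr := Real.rpow_le_rpow_of_exponent_ge hr0 hr1 hα1
    rw [Real.rpow_one] at hrr
    calc |latticeKernel (x - y) - latticeKernel x| ≤ 16 * ‖y‖ / ‖x‖ :=
          abs_latticeKernel_sub_le_of_norm hx h
      _ ≤ 32 * ((1 + ‖y‖) / (1 + ‖x‖)) := by
          rw [← mul_div_assoc, div_le_div_iff₀ (by positivity) (by positivity)]
          nlinarith
      _ ≤ 32 * (((1 + ‖y‖) / (1 + ‖x‖)) ^ α * (1 + ‖y‖) ^ δ) := by
          gcongr
          exact hrr.trans (le_mul_of_one_le_right hrα.le hδy)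
      _ ≤ _ := by
          gcongr
          exact le_max_left _ _
  · have hb : ∀ z : ℤ × ℤ, ‖z‖ ≤ 5 * (1 + ‖y‖) → latticeKernel z ≤ 5 * C * (1 + ‖y‖) ^ δ := by
      intro z hz
      calc latticeKernel z ≤ C * ‖z‖ ^ δ := hC z
        _ ≤ C * (5 * (1 + ‖y‖)) ^ δ := by gcongr
        _ = C * (5 ^ δ * (1 + ‖y‖) ^ δ) := by
            rw [Real.mul_rpow (by norm_num) (by positivity)]
        _ ≤ C * (5 ^ (1 : ℝ) * (1 + ‖y‖) ^ δ) := by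
            gcongr
            norm_num
        _ = _ := by rw [Real.rpow_one]; ring
    have h1 := hb (x - y) ((norm_sub_le x y).trans (by linarith))
    have h2 := hb x (by linarith)
    have h3 := latticeKernel_nonneg (x - y)
    have h4 := latticeKernel_nonneg x
    have h5 : 1 ≤ 4 * ((1 + ‖y‖) / (1 + ‖x‖)) ^ α := by
      have hq : (1 : ℝ) / 4 ≤ (1 + ‖y‖) / (1 + ‖x‖) := by
        rw [div_le_div_iff₀ (by norm_num) (by positivity)]
        linarith
      have hq2 : ((1 : ℝ) / 4) ^ α ≤ ((1 + ‖y‖) / (1 + ‖x‖)) ^ α := by gcongr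
      have hq3 := Real.rpow_le_rpow_of_exponent_ge (by norm_num : (0 : ℝ) < 1 / 4)
        (by norm_num) hα1
      rw [Real.rpow_one] at hq3
      linarith
    have hP : 0 ≤ 5 * C * (1 + ‖y‖) ^ δ := by positivity
    calc |latticeKernel (x - y) - latticeKernel x| ≤ 2 * (5 * C * (1 + ‖y‖) ^ δ) := by
          rw [abs_le]; constructor <;> linarith
      _ ≤ 2 * (5 * C * (1 + ‖y‖) ^ δ) * (4 * ((1 + ‖y‖) / (1 + ‖x‖)) ^ α) :=
          le_mul_of_one_le_right (by positivity) h5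
      _ = 40 * C * (((1 + ‖y‖) / (1 + ‖x‖)) ^ α * (1 + ‖y‖) ^ δ) := by ring
      _ ≤ _ := by
          gcongr
          exact le_max_right _ _

/-! ### Poisson equation with decaying right-hand side. -/

theorem summable_one_add_norm_rpow {k : ℝ} (hk : 2 < k) :
    Summable fun x : ℤ × ℤ => (1 + ‖x‖) ^ (-k) := by
  have h := (finTwoArrowEquiv ℤ).symm.summable_iff.2
    (EisensteinSeries.summable_one_div_norm_rpow hk)
  refine Summable.of_norm_bounded_eventually h ?_
  filter_upwards [tendsto_norm_intPair.eventually_ge_atTop 1] with x hx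
  rw [Real.norm_of_nonneg (by positivity)]
  obtain ⟨a, b⟩ := x
  have e : ‖(finTwoArrowEquiv ℤ).symm (a, b)‖ = ‖(a, b)‖ := by
    rw [EisensteinSeries.norm_eq_max_natAbs, norm_intPair]
    simp [Nat.cast_natAbs]
  simp only [Function.comp_apply, e]
  exact Real.rpow_le_rpow_of_nonpos (by linarith) (by linarith) (by linarith)

theorem summable_of_decay {τ C : ℝ} (hτ : 2 < τ) {f : ℤ × ℤ → ℝ}
    (hf : ∀ x, |f x| ≤ C * (1 + ‖x‖) ^ (-τ)) : Summable f :=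
  Summable.of_norm_bounded ((summable_one_add_norm_rpow hτ).mul_left C) hf

/-- The convolution of the potential kernel with `f`, minus the multiple of the kernel that
carries the total mass of `f`, decays at infinity. -/
theorem exists_poisson_solution {τ C : ℝ} (hτ : 2 < τ) {f : ℤ × ℤ → ℝ}
    (hf : ∀ x, |f x| ≤ C * (1 + ‖x‖) ^ (-τ)) :
    ∃ v : ℤ × ℤ → ℝ,
      (∀ x, latticeLaplacian v x = f x - if x = 0 then ∑' y, f y else 0) ∧
      ∃ B, ∀ x, |v x| ≤ B * (1 + ‖x‖) ^ ((2 - τ) / (τ + 1)) := by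
  -- This is the decay exponent to be proved. Since `α < τ - 2`, there is room for `δ > 0` with `τ -
  -- α - δ > 2`, which makes the weighted sum over `y` converge.
  set α := (τ - 2) / (τ + 1) with hα
  have hα0 : 0 < α := div_pos (by linarith) (by linarith)
  have hα1 : α ≤ 1 := by rw [hα, div_le_one (by linarith)]; linarith
  have hατ : α < τ - 2 := by
    rw [hα, div_lt_iff₀ (by linarith)]; nlinarith
  set δ := min 1 ((τ - 2 - α) / 2) with hδ
  have hδ0 : 0 < δ := lt_min one_pos (by linarith)
  have hδ1 : δ ≤ 1 := min_le_left _ _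
  have hδ2 : δ ≤ (τ - 2 - α) / 2 := min_le_right _ _
  obtain ⟨A, hA0, hA⟩ := exists_abs_latticeKernel_sub_le hα0 hα1 hδ0 hδ1
  have hC0 : 0 ≤ C := by
    have := hf 0
    rw [norm_zero, add_zero, Real.one_rpow, mul_one] at this
    exact (abs_nonneg _).trans this
  have hsum := summable_one_add_norm_rpow (k := τ - α - δ) (by linarith)
  have hterm : ∀ x y : ℤ × ℤ, ‖(latticeKernel (x - y) - latticeKernel x) / Real.pi * f y‖ ≤
      A * C * (1 + ‖x‖) ^ (-α) / Real.pi * (1 + ‖y‖) ^ (-(τ - α - δ)) := by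
    intro x y
    rw [norm_mul, norm_div, Real.norm_eq_abs, Real.norm_eq_abs, Real.norm_eq_abs,
      abs_of_pos Real.pi_pos]
    have e : (1 + ‖y‖) ^ (-(τ - α - δ)) = (1 + ‖y‖) ^ (α + δ) * (1 + ‖y‖) ^ (-τ) := by
      rw [← Real.rpow_add (by positivity)]; congr 1; ring
    calc _ ≤ A * ((1 + ‖y‖) ^ (α + δ) * (1 + ‖x‖) ^ (-α)) / Real.pi *
          (C * (1 + ‖y‖) ^ (-τ)) := by
          gcongr
          · exact hA x y
          · exact hf y
      _ = _ := by rw [e]; ring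
  have hsx : ∀ x, Summable fun y => (latticeKernel (x - y) - latticeKernel x) / Real.pi * f y :=
    fun x => Summable.of_norm_bounded (hsum.mul_left _) (hterm x)
  refine ⟨fun x => ∑' y, (latticeKernel (x - y) - latticeKernel x) / Real.pi * f y, ?_,
    A * C / Real.pi * ∑' y : ℤ × ℤ, (1 + ‖y‖) ^ (-(τ - α - δ)), ?_⟩
  · rintro ⟨a, b⟩
    rw [latticeLaplacian_apply]
    have hs := ((((hsx (a + 1, b)).hasSum.add (hsx (a - 1, b)).hasSum).add
      (hsx (a, b + 1)).hasSum).add (hsx (a, b - 1)).hasSum).sub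
      ((hsx (a, b)).hasSum.mul_left 4)
    have hf1 : HasSum (fun y : ℤ × ℤ => if y = (a, b) then f (a, b) else 0)
        (f (a, b)) := hasSum_ite_eq (a, b) (f (a, b))
    have hf2 : HasSum (fun y : ℤ × ℤ => if ((a, b) : ℤ × ℤ) = 0 then f y else 0)
        (if ((a, b) : ℤ × ℤ) = 0 then ∑' y, f y else 0) := by
      split_ifs
      · exact (summable_of_decay hτ hf).hasSum
      · exact hasSum_zero
    refine hs.unique ?_
    convert hf1.sub hf2 using 1
    funext ⟨c, d⟩
    have e1 := latticeLaplacian_latticeKernel (a - c, b - d)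
    have e2 := latticeLaplacian_latticeKernel (a, b)
    rw [latticeLaplacian_apply] at e1 e2
    have e3 : ((a - c, b - d) : ℤ × ℤ) = 0 ↔ ((c, d) : ℤ × ℤ) = (a, b) := by
      simp only [Prod.ext_iff, Prod.fst_zero, Prod.snd_zero]
      omega
    simp only [e3] at e1
    have e4 : (if ((c, d) : ℤ × ℤ) = (a, b) then f (a, b) else 0) =
        (if ((c, d) : ℤ × ℤ) = (a, b) then Real.pi else 0) / Real.pi * f (c, d) := by
      split_ifs with h
      · rw [h, div_self Real.pi_ne_zero, one_mul]
      · simp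
    have e5 : (if ((a, b) : ℤ × ℤ) = 0 then f (c, d) else 0) =
        (if ((a, b) : ℤ × ℤ) = 0 then Real.pi else 0) / Real.pi * f (c, d) := by
      split_ifs with h
      · rw [div_self Real.pi_ne_zero, one_mul]
      · simp
    rw [e4, e5, ← e1, ← e2]
    simp only [Prod.mk_sub_mk, add_sub_right_comm, sub_right_comm _ (1 : ℤ)]
    ring
  · intro x
    rw [show (2 - τ) / (τ + 1) = -α by rw [hα]; ring]
    have := tsum_of_norm_bounded ((hsum.mul_left (A * C * (1 + ‖x‖) ^ (-α) / Real.pi)).hasSum)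
      (hterm x)
    rw [tsum_mul_left, Real.norm_eq_abs] at this
    refine this.trans_eq ?_
    ring

theorem abs_le_abs_of_decay {τ A : ℝ} (hτ : 2 < τ) {v : ℤ × ℤ → ℝ}
    (hv : ∀ x, |v x| ≤ A * (1 + ‖x‖) ^ ((2 - τ) / (τ + 1))) (x : ℤ × ℤ) : |v x| ≤ |A| := by
  refine (hv x).trans ((mul_le_mul_of_nonneg_right (le_abs_self A) (by positivity)).trans ?_)
  refine mul_le_of_le_one_right (abs_nonneg A) (Real.rpow_le_one_of_one_le_of_nonpos ?_ ?_)
  · linarith [norm_nonneg x]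
  · exact div_nonpos_of_nonpos_of_nonneg (by linarith) (by linarith)

/-- If the mass `m` were positive, `u - v - (m/π) a` would be harmonic and bounded above, hence
constant. Then `u` would grow like `(m/π) a`, against its upper bound. -/
theorem tsum_nonpos_of_laplacian_of_le {τ C B : ℝ} (hτ : 2 < τ) {u f : ℤ × ℤ → ℝ}
    (hu : ∀ x, u x ≤ B) (hΔ : ∀ x, latticeLaplacian u x = f x)
    (hf : ∀ x, |f x| ≤ C * (1 + ‖x‖) ^ (-τ)) :
    ∑' x, f x ≤ 0 := by
  by_contra! hm
  set m := ∑' x, f x with hmdef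
  obtain ⟨v, hv, A, hA⟩ := exists_poisson_solution hτ hf
  have hvA : ∀ x, |v x| ≤ |A| := abs_le_abs_of_decay hτ hA
  set h : ℤ × ℤ → ℝ := fun x => u x - v x - m / Real.pi * latticeKernel x with hh
  have hharm : ∀ x, latticeLaplacian h x = 0 := by
    rintro ⟨p, q⟩
    have e1 := hΔ (p, q)
    have e2 := hv (p, q)
    have e3 := latticeLaplacian_latticeKernel (p, q)
    have e4 : (if ((p, q) : ℤ × ℤ) = 0 then m else 0) =
        m / Real.pi * (if ((p, q) : ℤ × ℤ) = 0 then Real.pi else 0) := by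
      split_ifs
      · field_simp
      · simp
    rw [e4] at e2
    rw [latticeLaplacian_apply] at e1 e2 e3 ⊢
    simp only [hh]
    linear_combination e1 - e2 - m / Real.pi * e3
  have hbd : ∀ x, h x ≤ B + |A| := by
    intro x
    have h1 := abs_le.1 (hvA x)
    have h2 := hu x
    have h3 : 0 ≤ m / Real.pi * latticeKernel x := by
      have := latticeKernel_nonneg x
      positivity
    simp only [hh]
    linarith
  have hconst := eq_of_subharmonic_of_bddAbove hbd (fun x => (hharm x).ge)
  have ht := tendsto_latticeKernel.const_mul_atTop (div_pos hm Real.pi_pos)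
  obtain ⟨x, hx⟩ := (ht.eventually_gt_atTop (B + |A| - h 0)).exists
  have h1 := abs_le.1 (hvA x)
  have h2 := hu x
  have h3 := hconst x 0
  simp only [hh] at h3 hx
  linarith

theorem tsum_eq_zero_and_asymptotics {τ C B : ℝ} (hτ : 2 < τ) {u f : ℤ × ℤ → ℝ}
    (hu : ∀ x, |u x| ≤ B) (hΔ : ∀ x, latticeLaplacian u x = f x)
    (hf : ∀ x, |f x| ≤ C * (1 + ‖x‖) ^ (-τ)) :
    ∑' x, f x = 0 ∧ ∃ c A, ∀ x, |u x - c| ≤ A * (1 + ‖x‖) ^ ((2 - τ) / (τ + 1)) := by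
  have hu' := fun x => abs_le.1 (hu x)
  have h1 : ∑' x, f x ≤ 0 :=
    tsum_nonpos_of_laplacian_of_le hτ (fun x => (hu' x).2) hΔ hf
  have h2 : ∑' x, -f x ≤ 0 := by
    refine tsum_nonpos_of_laplacian_of_le (u := fun x => -u x) (B := B) (C := C) hτ ?_ ?_ ?_
    · intro x; have := (hu' x).1; linarith
    · rintro ⟨p, q⟩
      have e1 := hΔ (p, q)
      rw [latticeLaplacian_apply] at e1 ⊢
      linear_combination -e1
    · intro x; rw [abs_neg]; exact hf x
  rw [tsum_neg] at h2
  have h0 : ∑' x, f x = 0 := by linarith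
  refine ⟨h0, ?_⟩
  obtain ⟨v, hv, A, hA⟩ := exists_poisson_solution hτ hf
  have hvA : ∀ x, |v x| ≤ |A| := abs_le_abs_of_decay hτ hA
  have hharm : ∀ x, latticeLaplacian (fun x => u x - v x) x = 0 := by
    rintro ⟨p, q⟩
    have e1 := hΔ (p, q)
    have e2 := hv (p, q)
    rw [h0, ite_self] at e2
    rw [latticeLaplacian_apply] at e1 e2 ⊢
    linear_combination e1 - e2
  have hconst := eq_of_subharmonic_of_bddAbove (u := fun x => u x - v x) (B := B + |A|)
    (fun x => by have := (hu' x).2; have := abs_le.1 (hvA x); linarith) (fun x => (hharm x).ge)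
  refine ⟨u 0 - v 0, A, fun x => ?_⟩
  rw [← hconst x 0, sub_sub_cancel]
  exact hA x

/-! ### Comparison principle and Perron's method. -/

/-- The positive part of `u - v` is subharmonic and bounded above, hence constant; the alternatives
are a zero and a positive constant. -/
theorem le_or_eq_add_of_subharmonic {u v : ℤ × ℤ → ℝ} {B : ℝ} (hB : ∀ x, u x - v x ≤ B)
    (h : ∀ x, v x < u x → latticeLaplacian v x ≤ latticeLaplacian u x) :
    (∀ x, u x ≤ v x) ∨ ∃ c, 0 < c ∧ ∀ x, u x = v x + c := by
  set p : ℤ × ℤ → ℝ := fun x => max (u x - v x) 0 with hp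
  have p1 : ∀ x, u x - v x ≤ p x := fun x => le_max_left _ _
  have p0 : ∀ x, 0 ≤ p x := fun x => le_max_right _ _
  have hconst := eq_of_subharmonic_of_bddAbove (u := p) (B := max B 0)
    (fun x => max_le_max (hB x) le_rfl) (by
      rintro ⟨a, b⟩
      rw [latticeLaplacian_apply]
      rcases le_or_gt (u (a, b)) (v (a, b)) with hle | hlt
      · have : p (a, b) = 0 := max_eq_right (by linarith)
        have := p0 (a + 1, b)
        have := p0 (a - 1, b)
        have := p0 (a, b + 1)
        have := p0 (a, b - 1)
        linarith
      · have : p (a, b) = u (a, b) - v (a, b) := max_eq_left (by linarith)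
        have := p1 (a + 1, b)
        have := p1 (a - 1, b)
        have := p1 (a, b + 1)
        have := p1 (a, b - 1)
        have := h (a, b) hlt
        rw [latticeLaplacian_apply, latticeLaplacian_apply] at this
        linarith)
  rcases (p0 0).eq_or_lt with h0 | h0
  · left
    intro x
    have := p1 x
    rw [hconst x 0] at this
    linarith
  · right
    refine ⟨p 0, h0, fun x => ?_⟩
    have h1 : 0 < p x := by rw [hconst x 0]; exact h0
    have h2 : p x = u x - v x := by
      simp only [hp] at h1 ⊢
      refine max_eq_left ?_
      by_contra! hc
      rw [max_eq_right hc.le] at h1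
      exact lt_irrefl _ h1
    rw [hconst 0 x, h2]
    ring

/-- Perron's method between a subsolution and a constant supersolution. -/
theorem exists_solution_of_subsolution {κ M : ℝ} (hκ : 0 < κ) {K g v : ℤ × ℤ → ℝ}
    (hK : ∀ x, 0 ≤ K x) (hM : ∀ x, g x ≤ K x * Real.exp (κ * M)) (hvM : ∀ x, v x ≤ M)
    (hv : ∀ x, -latticeLaplacian v x + K x * Real.exp (κ * v x) ≤ g x) :
    ∃ u : ℤ × ℤ → ℝ, (∀ x, v x ≤ u x) ∧ (∀ x, u x ≤ M) ∧
      ∀ x, -latticeLaplacian u x + K x * Real.exp (κ * u x) = g x := by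
  let S : Set (ℤ × ℤ → ℝ) := {w | (∀ x, w x ≤ M) ∧
    ∀ x, -latticeLaplacian w x + K x * Real.exp (κ * w x) ≤ g x}
  have hvS : v ∈ S := ⟨hvM, hv⟩
  have : Nonempty S := ⟨⟨v, hvS⟩⟩
  set u : ℤ × ℤ → ℝ := fun x => ⨆ w : S, w.1 x with hu
  have hbdd : ∀ x, BddAbove (Set.range fun w : S => w.1 x) :=
    fun x => ⟨M, by rintro _ ⟨w, rfl⟩; exact w.2.1 x⟩
  have hle : ∀ w ∈ S, ∀ x, w x ≤ u x := fun w hw x => le_ciSup (hbdd x) ⟨w, hw⟩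
  have huM : ∀ x, u x ≤ M := fun x => ciSup_le fun w => w.2.1 x
  -- A subsolution satisfies `4w + K e^{κw} ≤ g + ∑ (neighbours)` at each point. The left side is
  -- increasing and continuous in `w`, so the inequality passes to suprema.
  have hmono : ∀ x, Monotone fun t : ℝ => 4 * t + K x * Real.exp (κ * t) := by
    intro x s t hst
    have := hK x
    simp only
    gcongr
  have hcont : ∀ x, Continuous fun t : ℝ => 4 * t + K x * Real.exp (κ * t) := by
    intro x
    fun_prop
  have husub : ∀ x, -latticeLaplacian u x + K x * Real.exp (κ * u x) ≤ g x := by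
    rintro ⟨a, b⟩
    have e := (hmono (a, b)).map_ciSup_of_continuousAt (hcont (a, b)).continuousAt
      (hbdd (a, b))
    have e2 : (⨆ w : S, (4 * w.1 (a, b) + K (a, b) * Real.exp (κ * w.1 (a, b)))) ≤
        g (a, b) + (u (a + 1, b) + u (a - 1, b) + u (a, b + 1) + u (a, b - 1)) := by
      refine ciSup_le fun w => ?_
      have i0 := w.2.2 (a, b)
      rw [latticeLaplacian_apply] at i0
      have i1 := hle w.1 w.2 (a + 1, b)
      have i2 := hle w.1 w.2 (a - 1, b)
      have i3 := hle w.1 w.2 (a, b + 1)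
      have i4 := hle w.1 w.2 (a, b - 1)
      linarith
    rw [latticeLaplacian_apply]
    have e3 : 4 * u (a, b) + K (a, b) * Real.exp (κ * u (a, b)) ≤
      g (a, b) + (u (a + 1, b) + u (a - 1, b) + u (a, b + 1) + u (a, b - 1)) := e.trans_le e2
    linarith
  refine ⟨u, hle v hvS, huM, fun x => (husub x).antisymm ?_⟩
  by_contra! hlt
  obtain ⟨a, b⟩ := x
  rw [latticeLaplacian_apply] at hlt
  set T := g (a, b) + (u (a + 1, b) + u (a - 1, b) + u (a, b + 1) + u (a, b - 1)) with hT
  have hMT : T ≤ 4 * M + K (a, b) * Real.exp (κ * M) := by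
    have := hM (a, b)
    have := huM (a + 1, b)
    have := huM (a - 1, b)
    have := huM (a, b + 1)
    have := huM (a, b - 1)
    linarith
  have hlt' : 4 * u (a, b) + K (a, b) * Real.exp (κ * u (a, b)) < T := by linarith
  -- Where the equation fails, raise the value at that one point until it holds; the supersolution
  -- `M` keeps the new value at most `M`. The result is still a subsolution and exceeds the supremum
  -- `u`.
  obtain ⟨t, ⟨ht0, ht1⟩, ht⟩ := intermediate_value_Icc (huM (a, b)) (hcont (a, b)).continuousOn
    ⟨hlt'.le, hMT⟩
  simp only at ht
  have hut : u (a, b) < t := by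
    refine lt_of_le_of_ne ht0 ?_
    rintro h
    rw [← h] at ht
    linarith
  have hupd : ∀ y, u y ≤ Function.update u (a, b) t y := by
    intro y
    by_cases hy : y = (a, b)
    · rw [hy, Function.update_self]; exact ht0
    · rw [Function.update_of_ne hy]
  have hmem : Function.update u (a, b) t ∈ S := by
    refine ⟨fun y => ?_, ?_⟩
    · by_cases hy : y = (a, b)
      · rw [hy, Function.update_self]; exact ht1
      · rw [Function.update_of_ne hy]; exact huM y
    · rintro ⟨c, d⟩
      have i1 := hupd (c + 1, d)
      have i2 := hupd (c - 1, d)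
      have i3 := hupd (c, d + 1)
      have i4 := hupd (c, d - 1)
      rw [latticeLaplacian_apply]
      by_cases hy : ((c, d) : ℤ × ℤ) = (a, b)
      · obtain ⟨rfl, rfl⟩ := Prod.mk.inj hy
        rw [Function.update_self]
        linarith
      · rw [Function.update_of_ne hy]
        have i0 := husub (c, d)
        rw [latticeLaplacian_apply] at i0
        linarith
  have := hle _ hmem (a, b)
  rw [Function.update_self] at this
  linarith

/-! ### From the Euclidean weights to the maximum norm and back. -/

theorem norm_le_latticeNorm (x : ℤ × ℤ) : ‖x‖ ≤ latticeNorm x := by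
  obtain ⟨a, b⟩ := x
  rw [norm_intPair]
  unfold latticeNorm
  refine max_le (Real.abs_le_sqrt ?_) (Real.abs_le_sqrt ?_) <;> simp only
  · nlinarith [sq_nonneg (b : ℝ)]
  · nlinarith [sq_nonneg (a : ℝ)]

theorem latticeNorm_le (x : ℤ × ℤ) : latticeNorm x ≤ 2 * ‖x‖ := by
  obtain ⟨a, b⟩ := x
  unfold latticeNorm
  refine Real.sqrt_le_iff.2 ⟨by positivity, ?_⟩
  rw [norm_intPair]
  have h1 := sq_le_sq' (by linarith [abs_nonneg (a : ℝ), le_max_left |(a : ℝ)| |(b : ℝ)|])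
    (le_max_left |(a : ℝ)| |(b : ℝ)|)
  have h2 := sq_le_sq' (by linarith [abs_nonneg (b : ℝ), le_max_right |(a : ℝ)| |(b : ℝ)|])
    (le_max_right |(a : ℝ)| |(b : ℝ)|)
  rw [sq_abs] at h1 h2
  simp only
  nlinarith

theorem MemWeightedLinfty.exists_decay {τ : ℝ} (hτ : 0 ≤ τ) {f : ℤ × ℤ → ℝ}
    (hf : MemWeightedLinfty τ f) : ∃ C, 0 ≤ C ∧ ∀ x, |f x| ≤ C * (1 + ‖x‖) ^ (-τ) := by
  obtain ⟨C, hC⟩ := hf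
  have hC' : ∀ x, |f x| ≤ C * (1 + ‖x‖) ^ (-τ) := by
    intro x
    have h1 := hC (Set.mem_range_self x)
    have h2 := norm_le_latticeNorm x
    rw [Real.rpow_neg (by positivity), ← div_eq_mul_inv, le_div_iff₀ (by positivity)]
    refine le_trans ?_ h1
    gcongr
  refine ⟨C, ?_, hC'⟩
  have := hC' 0
  rw [norm_zero, add_zero, Real.one_rpow, mul_one] at this
  exact (abs_nonneg _).trans this

/-- The pure power already suffices: the logarithmic factor is at least `1` once `‖x‖ ≥ 3 > e`. -/
theorem isBigO_of_decay {τ c A : ℝ} (hτ : 2 < τ) {u : ℤ × ℤ → ℝ}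
    (h : ∀ x, |u x - c| ≤ A * (1 + ‖x‖) ^ ((2 - τ) / (τ + 1))) :
    (fun x => u x - c) =O[cofinite]
      (fun x => latticeNorm x ^ ((2 - τ) / (τ + 1)) *
        Real.log (latticeNorm x) ^ (1 / (τ + 1))) := by
  set α := (τ - 2) / (τ + 1) with hα
  have hα0 : 0 ≤ α := div_nonneg (by linarith) (by linarith)
  have e : (2 - τ) / (τ + 1) = -α := by rw [hα]; ring
  rw [e] at h ⊢
  refine IsBigO.of_bound (|A| * 2 ^ α) ?_
  filter_upwards [tendsto_norm_intPair.eventually_ge_atTop 3] with x hx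
  have h1 := norm_le_latticeNorm x
  have h2 := latticeNorm_le x
  have hlog : 1 ≤ Real.log (latticeNorm x) := by
    rw [Real.le_log_iff_exp_le (by linarith)]
    linarith [Real.exp_one_lt_d9]
  have hlog' : 1 ≤ Real.log (latticeNorm x) ^ (1 / (τ + 1)) :=
    Real.one_le_rpow hlog (by apply div_nonneg <;> linarith)
  have hL : 0 ≤ latticeNorm x ^ (-α) := Real.rpow_nonneg (by linarith) _
  rw [Real.norm_eq_abs, Real.norm_of_nonneg (by positivity)]
  calc |u x - c| ≤ |A| * (1 + ‖x‖) ^ (-α) :=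
        (h x).trans (mul_le_mul_of_nonneg_right (le_abs_self A) (by positivity))
    _ ≤ |A| * (latticeNorm x / 2) ^ (-α) := by
        gcongr ?_ * ?_
        exact Real.rpow_le_rpow_of_nonpos (by linarith) (by linarith) (by linarith)
    _ = |A| * 2 ^ α * latticeNorm x ^ (-α) := by
        rw [Real.div_rpow (by linarith) (by norm_num), Real.rpow_neg (by norm_num : (0:ℝ) ≤ 2)]
        field_simp
    _ ≤ |A| * 2 ^ α * (latticeNorm x ^ (-α) * Real.log (latticeNorm x) ^ (1 / (τ + 1))) := by
        gcongr
        exact le_mul_of_one_le_right hL hlog'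

/-! ### Uniqueness, upper bound, existence and conclusion. -/

/-- Comparison leaves only `u = v + c` with `c > 0`. Then the Laplacians agree, but the exponential
terms differ at a point where `K > 0`. -/
theorem IsBoundedSolution.le {κ : ℝ} (hκ : 0 < κ) {K g u v : ℤ × ℤ → ℝ} (hK : ∀ x, 0 ≤ K x)
    (hK_ne : ∃ x, K x ≠ 0) (hu : IsBoundedSolution κ K g u) (hv : IsBoundedSolution κ K g v)
    (x : ℤ × ℤ) : u x ≤ v x := by
  obtain ⟨⟨B, hB⟩, hu⟩ := hu
  obtain ⟨⟨B', hB'⟩, hv⟩ := hv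
  have hexp : ∀ x, v x < u x → Real.exp (κ * v x) < Real.exp (κ * u x) := fun x h =>
    Real.exp_lt_exp.2 (mul_lt_mul_of_pos_left h hκ)
  rcases le_or_eq_add_of_subharmonic (u := u) (v := v) (B := B + B')
    (fun x => by linarith [abs_le.1 (hB x), abs_le.1 (hB' x)])
    (fun x h => by
      have := mul_le_mul_of_nonneg_left (hexp x h).le (hK x)
      linarith [hu x, hv x]) with h | ⟨c, hc, h⟩
  · exact h x
  · exfalso
    obtain ⟨⟨a, b⟩, hz⟩ := hK_ne
    have hz' : 0 < K (a, b) := lt_of_le_of_ne (hK _) hz.symm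
    have e1 := hu (a, b)
    have e2 := hv (a, b)
    rw [latticeLaplacian_apply] at e1 e2
    have h1 := mul_lt_mul_of_pos_left (hexp (a, b) (by linarith [h (a, b)])) hz'
    linarith [h (a, b), h (a + 1, b), h (a - 1, b), h (a, b + 1), h (a, b - 1)]

/-- The constant `(1/κ) ln S` is a supersolution, and a solution lying a positive constant above it
fails at a point where `K > 0`. -/
theorem IsBoundedSolution.le_log {κ S : ℝ} (hκ : 0 < κ) {K g u : ℤ × ℤ → ℝ}
    (hK : ∀ x, 0 ≤ K x) (hK_ne : ∃ x, K x ≠ 0) (hS : 0 < S) (hgS : ∀ x, g x ≤ S * K x)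
    (hu : IsBoundedSolution κ K g u) (x : ℤ × ℤ) : u x ≤ 1 / κ * Real.log S := by
  obtain ⟨⟨B, hB⟩, hu⟩ := hu
  set M := 1 / κ * Real.log S with hM
  have hexp : ∀ x, M < u x → S < Real.exp (κ * u x) := fun x h => by
    rw [← Real.log_lt_iff_lt_exp hS]
    have := mul_lt_mul_of_pos_left h hκ
    rwa [hM, ← mul_assoc, mul_one_div_cancel hκ.ne', one_mul] at this
  have hzero : ∀ x, latticeLaplacian (fun _ => M) x = 0 := fun x => by
    simp [latticeLaplacian]
  rcases le_or_eq_add_of_subharmonic (u := u) (v := fun _ => M) (B := B - M)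
    (fun x => by linarith [abs_le.1 (hB x)])
    (fun x h => by
      have := mul_le_mul_of_nonneg_left (hexp x h).le (hK x)
      rw [hzero]
      linarith [hu x, hgS x]) with h | ⟨c, hc, h⟩
  · exact h x
  · exfalso
    obtain ⟨⟨a, b⟩, hz⟩ := hK_ne
    have hz' : 0 < K (a, b) := lt_of_le_of_ne (hK _) hz.symm
    have e1 := hu (a, b)
    rw [latticeLaplacian_apply] at e1
    have h1 := mul_lt_mul_of_pos_left (hexp (a, b) (by linarith [h (a, b)])) hz'
    linarith [h (a, b), h (a + 1, b), h (a - 1, b), h (a, b + 1), h (a, b - 1), hgS (a, b)]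

theorem exists_isBoundedSolution {κ τ C₀ : ℝ} (hκ : 0 < κ) (hτ : 2 < τ) {K g : ℤ × ℤ → ℝ}
    (hK : MemWeightedLinfty τ K) (hg : MemWeightedLinfty τ g) (hK_nonneg : ∀ x, 0 ≤ K x)
    (hK_ne : ∃ x, K x ≠ 0) (hg_sum : 0 < ∑' x, g x) (hgK : ∀ x, g x ≤ C₀ * K x) :
    ∃ u, IsBoundedSolution κ K g u := by
  obtain ⟨A, hA0, hA⟩ := hK.exists_decay (by linarith)
  obtain ⟨B, hB0, hB⟩ := hg.exists_decay (by linarith)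
  have sK := summable_of_decay hτ hA
  have sg := summable_of_decay hτ hB
  have hKpos : 0 < ∑' x, K x := by
    obtain ⟨z, hz⟩ := hK_ne
    exact sK.tsum_pos hK_nonneg z (lt_of_le_of_ne (hK_nonneg z) hz.symm)
  set c := (∑' x, g x) / ∑' x, K x with hc
  have hc0 : 0 < c := div_pos hg_sum hKpos
  have hf : ∀ x, |g x - c * K x| ≤ (B + c * A) * (1 + ‖x‖) ^ (-τ) := by
    intro x
    have h1 := hA x
    have h2 := hB x
    calc |g x - c * K x| ≤ |g x| + |c * K x| := abs_sub _ _
      _ = |g x| + c * |K x| := by rw [abs_mul, abs_of_pos hc0]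
      _ ≤ B * (1 + ‖x‖) ^ (-τ) + c * (A * (1 + ‖x‖) ^ (-τ)) := by gcongr
      _ = _ := by ring
  have hsum : ∑' x, (g x - c * K x) = 0 := by
    rw [sg.tsum_sub (sK.mul_left c), tsum_mul_left, hc, div_mul_cancel₀ _ hKpos.ne', sub_self]
  obtain ⟨v, hv, D, hD⟩ := exists_poisson_solution hτ hf
  have hvD : ∀ x, |v x| ≤ |D| := abs_le_abs_of_decay hτ hD
  -- The maximum with `1` makes the argument of the logarithm positive without first proving `C₀ >
  -- 0`.
  have hC1 : (0 : ℝ) < max C₀ 1 := lt_max_of_lt_right one_pos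
  set M := Real.log (max C₀ 1) / κ with hMdef
  -- The first entry gives `e^{κ(-v - E)} ≤ c`, so `-v - E` is a subsolution; the second puts it
  -- below `M`.
  set E := max (|D| - Real.log c / κ) (|D| - M) with hE
  have hE1 : |D| - Real.log c / κ ≤ E := le_max_left _ _
  have hE2 : |D| - M ≤ E := le_max_right _ _
  obtain ⟨u, hu1, hu2, hu⟩ := exists_solution_of_subsolution (v := fun x => -v x - E) (M := M)
    (g := g) hκ hK_nonneg
    (fun x => by
      rw [hMdef, mul_div_cancel₀ _ hκ.ne', Real.exp_log hC1, mul_comm]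
      exact (hgK x).trans (mul_le_mul_of_nonneg_right (le_max_left _ _) (hK_nonneg x)))
    (fun x => by linarith [abs_le.1 (hvD x)])
    (by
      rintro ⟨a, b⟩
      have e := hv (a, b)
      rw [hsum, ite_self] at e
      rw [latticeLaplacian_apply] at e ⊢
      have h1 : Real.exp (κ * (-v (a, b) - E)) ≤ c := by
        rw [← Real.le_log_iff_exp_le hc0, mul_comm, ← le_div_iff₀ hκ]
        linarith [abs_le.1 (hvD (a, b))]
      have h2 := mul_le_mul_of_nonneg_left h1 (hK_nonneg (a, b))
      linarith)
  refine ⟨u, ⟨max |M| (|D| + |E|), fun x => abs_le.2 ⟨?_, ?_⟩⟩, hu⟩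
  · have h1 := hu1 x
    have h2 := abs_le.1 (hvD x)
    have h3 := le_abs_self E
    have h4 := le_max_right |M| (|D| + |E|)
    linarith
  · exact (hu2 x).trans ((le_abs_self M).trans (le_max_left _ _))

theorem ofReal_iSup_le_quotientSupNorm {K g : ℤ × ℤ → ℝ} (hK_ne : ∃ x, K x ≠ 0) :
    ENNReal.ofReal (⨆ x : Function.support K, g x / K x) ≤ quotientSupNorm g K := by
  by_cases hQ : quotientSupNorm g K = ⊤
  · rw [hQ]; exact le_top
  have : Nonempty (Function.support K) := ⟨⟨hK_ne.choose, hK_ne.choose_spec⟩⟩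
  refine ENNReal.ofReal_le_of_le_toReal (ciSup_le fun x => ?_)
  refine (le_abs_self _).trans ((ENNReal.ofReal_le_iff_le_toReal hQ).1 ?_)
  exact le_iSup₂ (f := fun x (_ : x ∈ Function.support K) => ENNReal.ofReal |g x / K x|)
    x.1 x.2

theorem proposition3p2 (κ τ₀ : ℝ) (hκ : 0 < κ) (hτ₀ : 2 < τ₀) (K g : ℤ × ℤ → ℝ)
    (hK : MemWeightedLinfty τ₀ K) (hg : MemWeightedLinfty τ₀ g)
    (hK_nonneg : ∀ x, 0 ≤ K x) (hK_ne : ∃ x, K x ≠ 0)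
    (hg_sum : 0 < ∑' x, g x)
    (hgK : ∃ C₀ : ℝ, ∀ x, g x ≤ C₀ * K x) :
    ∃ w₀ : ℤ × ℤ → ℝ,
      IsBoundedSolution κ K g w₀ ∧
      (∀ u : ℤ × ℤ → ℝ, IsBoundedSolution κ K g u → u = w₀) ∧
      HasSum (fun x => K x * Real.exp (κ * w₀ x)) (∑' x, g x) ∧
      ∃ w_inf : ℝ,
        (fun x => w₀ x - w_inf) =O[cofinite]
          (fun x => latticeNorm x ^ ((2 - τ₀) / (τ₀ + 1)) *
            Real.log (latticeNorm x) ^ (1 / (τ₀ + 1))) ∧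
        w_inf ≤ 1 / κ * Real.log (⨆ x : Function.support K, g x / K x) ∧
        (w_inf : EReal) ≤ ((1 / κ : ℝ) : EReal) * ENNReal.log (quotientSupNorm g K) := by
  obtain ⟨C₀, hC₀⟩ := hgK
  obtain ⟨w, hw⟩ := exists_isBoundedSolution hκ hτ₀ hK hg hK_nonneg hK_ne hg_sum hC₀
  refine ⟨w, hw, fun u hu => funext fun x => le_antisymm
    (hu.le hκ hK_nonneg hK_ne hw x) (hw.le hκ hK_nonneg hK_ne hu x), ?_⟩
  obtain ⟨A, hA0, hA⟩ := hK.exists_decay (by linarith)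
  obtain ⟨B, hB0, hB⟩ := hg.exists_decay (by linarith)
  have sg := summable_of_decay hτ₀ hB
  obtain ⟨⟨W, hW⟩, heq⟩ := id hw
  have hKe : ∀ x, |K x * Real.exp (κ * w x)| ≤
      (Real.exp (κ * W) * A) * (1 + ‖x‖) ^ (-τ₀) := by
    intro x
    have h1 : Real.exp (κ * w x) ≤ Real.exp (κ * W) := by
      have := (abs_le.1 (hW x)).2
      gcongr
    rw [abs_mul, Real.abs_exp]
    calc |K x| * Real.exp (κ * w x) ≤ (A * (1 + ‖x‖) ^ (-τ₀)) * Real.exp (κ * W) := by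
          gcongr
          exact hA x
      _ = _ := by ring
  have sKe := summable_of_decay hτ₀ hKe
  obtain ⟨hsum, w_inf, D, hD⟩ := tsum_eq_zero_and_asymptotics (u := w) (B := W)
    (f := fun x => K x * Real.exp (κ * w x) - g x) (C := Real.exp (κ * W) * A + B) hτ₀ hW
    (fun x => by linarith [heq x])
    (fun x => by
      refine (abs_sub _ _).trans ?_
      rw [add_mul]
      exact add_le_add (hKe x) (hB x))
  rw [sKe.tsum_sub sg, sub_eq_zero] at hsum
  refine ⟨hsum ▸ sKe.hasSum, w_inf, isBigO_of_decay hτ₀ hD, ?_⟩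
  set S := ⨆ x : Function.support K, g x / K x with hSdef
  have hbdd : BddAbove (Set.range fun x : Function.support K => g x / K x) := by
    refine ⟨C₀, ?_⟩
    rintro _ ⟨x, rfl⟩
    exact (div_le_iff₀ (lt_of_le_of_ne (hK_nonneg x) (Ne.symm x.2))).2 (hC₀ x)
  have hgS : ∀ x, g x ≤ S * K x := by
    intro x
    by_cases hx : K x = 0
    · have := hC₀ x
      rw [hx, mul_zero] at this ⊢
      exact this
    · rw [← div_le_iff₀ (lt_of_le_of_ne (hK_nonneg x) (Ne.symm hx))]
      exact le_ciSup hbdd ⟨x, hx⟩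
  -- Otherwise `g ≤ S K ≤ 0`, contradicting `∑ g > 0`. Positivity ensures that `Real.log S` is not a
  -- default value.
  have hS : 0 < S := by
    by_contra! hS
    refine absurd (tsum_nonpos fun x => ?_) (not_le.2 hg_sum)
    exact (hgS x).trans (mul_nonpos_of_nonpos_of_nonneg hS (hK_nonneg x))
  have hlim : Tendsto w cofinite (nhds w_inf) := by
    rw [tendsto_iff_norm_sub_tendsto_zero]
    have h1 : Tendsto (fun x : ℤ × ℤ => D * (1 + ‖x‖) ^ (-((τ₀ - 2) / (τ₀ + 1)))) cofinite
        (nhds (D * 0)) :=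
      ((tendsto_rpow_neg_atTop (div_pos (by linarith) (by linarith))).comp
        (tendsto_atTop_add_const_left _ 1 tendsto_norm_intPair)).const_mul D
    rw [mul_zero] at h1
    refine squeeze_zero (fun x => norm_nonneg _) (fun x => ?_) h1
    have := hD x
    rwa [show (2 - τ₀) / (τ₀ + 1) = -((τ₀ - 2) / (τ₀ + 1)) by ring] at this
  -- The bound holds for `w` at every point and passes to the limit at infinity.
  have hle : w_inf ≤ 1 / κ * Real.log S :=
    le_of_tendsto hlim (Eventually.of_forall (hw.le_log hκ hK_nonneg hK_ne hS hgS))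
  refine ⟨hle, ?_⟩
  have h1 : ((Real.log S : ℝ) : EReal) ≤ ENNReal.log (quotientSupNorm g K) := by
    rw [← ENNReal.log_ofReal_of_pos hS]
    exact ENNReal.log_monotone (ofReal_iSup_le_quotientSupNorm hK_ne)
  calc (w_inf : EReal) ≤ ((1 / κ * Real.log S : ℝ) : EReal) := EReal.coe_le_coe_iff.2 hle
    _ = ((1 / κ : ℝ) : EReal) * ((Real.log S : ℝ) : EReal) := EReal.coe_mul _ _
    _ ≤ _ := mul_le_mul_of_nonneg_left h1 (EReal.coe_nonneg.2 (by positivity))
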